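/- Let $n\in\mathbb N$, $s\in(0,1]$ and $1\le p<\infty$ be such that $sp<n$, and put $p^\star_s=\frac{np}{n-sp}$. For a measurable function $u:\mathbb R^n\to\mathbb R$ define $[u]_{W^{s,p}(\mathbb R^n)}\in[0,\infty]$ by $$[u]_{W^{s,p}(\mathbb R^n)}=\left(s(1-s)\iint_{\mathbb R^n\times\mathbb R^n}\frac{|u(x)-u(y)|^p}{|x-y|^{n+sp}}\,dx\,dy\right)^{1/p}\quad\text{if } 0<s<1,$$ and $[u]_{W^{1,p}(\mathbb R^n)}=\|\nabla u\|_{L^p(\mathbb R^n)}$ if $s=1$, where $\nabla u$ is the weak gradient of $u$ (the value is $\infty$ if $u$ has no weak gradient in $L^p$). Let $$\dot W^{s,p}(\mathbb R^n)=\left\{u\in L^{p^\star_s}(\mathbb R^n)\ :\ [u]_{W^{s,p}(\mathbb R^n)}<\infty\right\},\qquad \|u\|_{\dot W^{s,p}(\mathbb R^n)}=[u]_{W^{s,p}(\mathbb R^n)},$$ functions being identified when they agree almost everywhere, and let $\mathcal D^{s,p}(\mathbb R^n)$ be the completion of $C_c^\infty(\mathbb R^n)$ with respect to $[\,\cdot\,]_{W^{s,p}(\mathbb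 R^n)}$, that is, the space of sequences in $C_c^\infty(\mathbb R^n)$ that are Cauchy for this seminorm, modulo sequences whose seminorm tends to $0$, with norm $\|\{(u_m)_m\}\|=\lim_{m\to\infty}[u_m]_{W^{s,p}(\mathbb R^n)}$. Then $\|\cdot\|_{\dot W^{s,p}(\mathbb R^n)}$ is a norm, with which $\dot W^{s,p}(\mathbb R^n)$ is a Banach space, and $C_c^\infty(\mathbb R^n)$ is a dense subspace of $\dot W^{s,p}(\mathbb R^n)$. Moreover, there is a linear isometric isomorphism $\mathcal J:\mathcal D^{s,p}(\mathbb R^n)\to\dot W^{s,p}(\mathbb R^n)$ such that $\mathcal J(\varphi)=\varphi$ for every $\varphi\in C_c^\infty(\mathbb R^n)$. -/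

import Mathlib

open MeasureTheory Set
open scoped ENNReal

noncomputable section

namespace HomSobolev

/-- The space `ℝⁿ` with its Euclidean norm and Lebesgue measure `volume`. -/
abbrev Rn (n : ℕ) : Type := EuclideanSpace ℝ (Fin n)

/-- Smooth compactly supported functions `ℝⁿ → ℝ` (the last argument is `∞ : ℕ∞`). -/
abbrev Cc (n : ℕ) : Type := TestFunction (⊤ : TopologicalSpace.Opens (Rn n)) ℝ ⊤

/-! ### The seminorms, with values in `[0, ∞]` -/

/-- The double integral `∬ |u(x) - u(y)|^p / |x - y|^(n + s p) dx dy` over `ℝⁿ × ℝⁿ`. -/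
def gagliardoEnergy (n : ℕ) (s p : ℝ) (u : Rn n → ℝ) : ℝ≥0∞ :=
  ∫⁻ z : Rn n × Rn n, ENNReal.ofReal (|u z.1 - u z.2| ^ p / ‖z.1 - z.2‖ ^ ((n : ℝ) + s * p))

/-- `g : ℝⁿ → ℝⁿ` is the weak (distributional) gradient of `u`: both are locally integrable and
`∫ u ∂_v φ = - ∫ ⟨g, v⟩ φ` for all test functions `φ` and all directions `v`. -/
structure IsWeakGradient {n : ℕ} (u : Rn n → ℝ) (g : Rn n → Rn n) : Prop where
  locallyIntegrable_fun : LocallyIntegrable u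
  locallyIntegrable_grad : LocallyIntegrable g
  integral_eq : ∀ (φ : Cc n) (v : Rn n),
    ∫ x, u x * fderiv ℝ φ x v = - ∫ x, inner ℝ (g x) v * φ x

/-- `‖∇u‖_{L^p}`, where `∇u` is the weak gradient of `u`; the value is `∞` if `u` has no weak
gradient. (The weak gradient is unique almost everywhere, so the infimum runs over one value.) -/
def gradientNorm (n : ℕ) (p : ℝ) (u : Rn n → ℝ) : ℝ≥0∞ :=
  ⨅ (g : Rn n → Rn n) (_ : IsWeakGradient u g), eLpNorm g (ENNReal.ofReal p) volume

/-- The normalized Gagliardo–Slobodeckiĭ seminorm `[u]_{W^{s,p}(ℝⁿ)} ∈ [0, ∞]`: for `s = 1` it is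
`‖∇u‖_{L^p}`, otherwise `(s (1 - s) ∬ |u(x) - u(y)|^p / |x - y|^(n + s p) dx dy)^(1/p)`. -/
def seminormW (n : ℕ) (s p : ℝ) (u : Rn n → ℝ) : ℝ≥0∞ :=
  if s = 1 then gradientNorm n p u
  else (ENNReal.ofReal (s * (1 - s)) * gagliardoEnergy n s p u) ^ (1 / p)

/-! ### Basic properties of the seminorms -/

/-- The difference quotient of order `n / p + s`. -/
def quot (n : ℕ) (s p : ℝ) (u : Rn n → ℝ) (z : Rn n × Rn n) : ℝ :=
  (‖z.1 - z.2‖ ^ ((n : ℝ) / p + s))⁻¹ * (u z.1 - u z.2)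

lemma energy_rpow {n : ℕ} {s p : ℝ} (hp : 1 ≤ p) (u : Rn n → ℝ) :
    gagliardoEnergy n s p u ^ (1 / p) = eLpNorm (quot n s p u) (ENNReal.ofReal p) volume := by
  have hp0 : 0 < p := by linarith
  rw [eLpNorm_eq_lintegral_rpow_enorm_toReal (by simpa using hp0) (by simp),
    ENNReal.toReal_ofReal hp0.le]
  congr 1
  refine lintegral_congr fun z => ?_
  rw [Real.enorm_eq_ofReal_abs, ENNReal.ofReal_rpow_of_nonneg (abs_nonneg _) hp0.le]
  congr 1
  have h0 : (0 : ℝ) ≤ ‖z.1 - z.2‖ := norm_nonneg _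
  rw [quot, abs_mul, abs_inv, abs_of_nonneg (Real.rpow_nonneg h0 _),
    Real.mul_rpow (by positivity) (abs_nonneg _), Real.inv_rpow (by positivity),
    ← Real.rpow_mul h0]
  have : ((n : ℝ) / p + s) * p = n + s * p := by field_simp
  rw [this]
  ring

lemma seminormW_of_ne {n : ℕ} {s p : ℝ} (hs : s ≠ 1) (hp : 1 ≤ p) (u : Rn n → ℝ) :
    seminormW n s p u = ENNReal.ofReal (s * (1 - s)) ^ (1 / p) *
      eLpNorm (quot n s p u) (ENNReal.ofReal p) volume := by
  rw [seminormW, if_neg hs, ENNReal.mul_rpow_of_nonneg _ _ (by positivity), energy_rpow hp]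

lemma quot_aesm {n : ℕ} {s p : ℝ} {u : Rn n → ℝ} (hu : AEStronglyMeasurable u volume) :
    AEStronglyMeasurable (quot n s p u) volume := by
  have h1 : AEStronglyMeasurable (fun z : Rn n × Rn n => u z.1) (volume.prod volume) :=
    hu.comp_quasiMeasurePreserving Measure.quasiMeasurePreserving_fst
  have h2 : AEStronglyMeasurable (fun z : Rn n × Rn n => u z.2) (volume.prod volume) :=
    hu.comp_quasiMeasurePreserving Measure.quasiMeasurePreserving_snd
  have h3 : Measurable fun z : Rn n × Rn n => (‖z.1 - z.2‖ ^ ((n : ℝ) / p + s))⁻¹ := by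
    fun_prop
  exact h3.aestronglyMeasurable.mul (h1.sub h2)

lemma quot_congr {n : ℕ} {s p : ℝ} {u v : Rn n → ℝ} (h : u =ᵐ[volume] v) :
    quot n s p u =ᵐ[volume] quot n s p v := by
  have h1 : ∀ᵐ z : Rn n × Rn n ∂(volume.prod volume), u z.1 = v z.1 :=
    Measure.quasiMeasurePreserving_fst.ae h
  have h2 : ∀ᵐ z : Rn n × Rn n ∂(volume.prod volume), u z.2 = v z.2 :=
    Measure.quasiMeasurePreserving_snd.ae h
  filter_upwards [h1, h2] with z hz1 hz2
  simp only [quot, hz1, hz2]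

lemma IsWeakGradient.congr {n : ℕ} {u v : Rn n → ℝ} {g : Rn n → Rn n}
    (hg : IsWeakGradient u g) (h : u =ᵐ[volume] v) : IsWeakGradient v g where
  locallyIntegrable_fun := hg.1.congr h
  locallyIntegrable_grad := hg.2
  integral_eq φ w := by
    rw [← hg.3 φ w]
    refine integral_congr_ae ?_
    filter_upwards [h] with x hx
    rw [hx]

lemma seminormW_congr {n : ℕ} {s p : ℝ} (hp : 1 ≤ p) {u v : Rn n → ℝ} (h : u =ᵐ[volume] v) :
    seminormW n s p u = seminormW n s p v := by
  by_cases hs : s = 1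
  · simp only [seminormW, if_pos hs, gradientNorm]
    congr! 3 with g
    exact ⟨fun H => H.congr h, fun H => H.congr h.symm⟩
  · rw [seminormW_of_ne hs hp, seminormW_of_ne hs hp, eLpNorm_congr_ae (quot_congr h)]

/-- A locally integrable function times a continuous compactly supported one is integrable. -/
lemma integrable_mul_cc {n : ℕ} {f k : Rn n → ℝ} (hf : LocallyIntegrable f)
    (hk : Continuous k) (hc : HasCompactSupport k) : Integrable fun x => f x * k x := by
  simpa [mul_comm] using hf.integrable_smul_left_of_hasCompactSupport hk hc

lemma cc_fderiv {n : ℕ} (φ : Cc n) (v : Rn n) :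
    Continuous (fun x => fderiv ℝ φ x v) ∧ HasCompactSupport (fun x => fderiv ℝ φ x v) :=
  ⟨(φ.contDiff.continuous_fderiv (by simp)).clm_apply continuous_const,
    φ.hasCompactSupport.fderiv_apply ℝ v⟩

lemma locInt_inner {n : ℕ} {g : Rn n → Rn n} (hg : LocallyIntegrable g) (v : Rn n) :
    LocallyIntegrable fun x => inner ℝ (g x) v := by
  intro x
  obtain ⟨U, hU, h⟩ := hg x
  exact ⟨U, hU, h.inner_const v⟩

lemma IsWeakGradient.add {n : ℕ} {u v : Rn n → ℝ} {g k : Rn n → Rn n}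
    (hg : IsWeakGradient u g) (hk : IsWeakGradient v k) : IsWeakGradient (u + v) (g + k) where
  locallyIntegrable_fun := hg.1.add hk.1
  locallyIntegrable_grad := hg.2.add hk.2
  integral_eq φ w := by
    obtain ⟨h1, h2⟩ := cc_fderiv φ w
    simp only [Pi.add_apply, add_mul, inner_add_left]
    rw [integral_add (integrable_mul_cc hg.1 h1 h2) (integrable_mul_cc hk.1 h1 h2),
      integral_add (integrable_mul_cc (locInt_inner hg.2 w) φ.continuous φ.hasCompactSupport)
        (integrable_mul_cc (locInt_inner hk.2 w) φ.continuous φ.hasCompactSupport),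
      hg.3, hk.3]
    ring

lemma IsWeakGradient.smul {n : ℕ} {u : Rn n → ℝ} {g : Rn n → Rn n}
    (hg : IsWeakGradient u g) (c : ℝ) : IsWeakGradient (c • u) (c • g) where
  locallyIntegrable_fun := hg.1.smul c
  locallyIntegrable_grad := hg.2.smul c
  integral_eq φ w := by
    simp only [Pi.smul_apply, smul_eq_mul, real_inner_smul_left, mul_assoc, integral_const_mul]
    rw [hg.3]
    ring

/-- The weak gradient is unique almost everywhere. -/
lemma IsWeakGradient.ae_eq {n : ℕ} {u : Rn n → ℝ} {g k : Rn n → Rn n}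
    (hg : IsWeakGradient u g) (hk : IsWeakGradient u k) : g =ᵐ[volume] k := by
  have h : ∀ v : Rn n, ∀ᵐ x, inner ℝ (g x) v - inner ℝ (k x) v = 0 := fun v => by
    refine ae_eq_zero_of_integral_contDiff_smul_eq_zero
      ((locInt_inner hg.2 v).sub (locInt_inner hk.2 v)) fun φ hφ hc => ?_
    let ψ : Cc n := ⟨φ, hφ, hc, by simp⟩
    have e1 := hg.3 ψ v
    have e2 := hk.3 ψ v
    have i1 := integrable_mul_cc (locInt_inner hg.2 v) ψ.continuous ψ.hasCompactSupport
    have i2 := integrable_mul_cc (locInt_inner hk.2 v) ψ.continuous ψ.hasCompactSupport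
    have : ∫ x, φ x • (inner ℝ (g x) v - inner ℝ (k x) v) =
        ∫ x, (inner ℝ (g x) v * ψ x - inner ℝ (k x) v * ψ x) := by
      refine integral_congr_ae (Filter.Eventually.of_forall fun x => ?_)
      change φ x * _ = _ * φ x - _ * φ x
      ring
    exact this.trans (by rw [integral_sub i1 i2]; linarith)
  have h' : ∀ᵐ x, ∀ i : Fin n, inner ℝ (g x) (EuclideanSpace.single i 1) -
      inner ℝ (k x) (EuclideanSpace.single i (1 : ℝ)) = 0 := ae_all_iff.2 fun i => h _
  filter_upwards [h'] with x hx
  ext i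
  have := hx i
  simp [EuclideanSpace.inner_single_right] at this
  linarith

/-- `gradientNorm` is the `L^p` norm of the weak gradient whenever there is one. -/
lemma gradientNorm_eq {n : ℕ} {p : ℝ} {u : Rn n → ℝ} {g : Rn n → Rn n}
    (hg : IsWeakGradient u g) : gradientNorm n p u = eLpNorm g (ENNReal.ofReal p) volume :=
  le_antisymm (iInf₂_le g hg) (le_iInf₂ fun _ hk => (eLpNorm_congr_ae (hg.ae_eq hk)).le)

lemma isWeakGradient_zero (n : ℕ) : IsWeakGradient (0 : Rn n → ℝ) 0 where
  locallyIntegrable_fun := locallyIntegrable_zero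
  locallyIntegrable_grad := locallyIntegrable_zero
  integral_eq φ w := by simp

lemma seminormW_add_le {n : ℕ} {s p : ℝ} (hp : 1 ≤ p) {u v : Rn n → ℝ}
    (hu : AEStronglyMeasurable u volume) (hv : AEStronglyMeasurable v volume) :
    seminormW n s p (u + v) ≤ seminormW n s p u + seminormW n s p v := by
  have hp' : (1 : ℝ≥0∞) ≤ ENNReal.ofReal p := by simpa using hp
  by_cases hs : s = 1
  · simp only [seminormW, if_pos hs, gradientNorm]
    simp only [ENNReal.iInf_add, ENNReal.add_iInf]
    refine le_iInf fun k => le_iInf fun hk => le_iInf fun g => le_iInf fun hg => ?_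
    refine (iInf₂_le (g + k) (hg.add hk)).trans (eLpNorm_add_le ?_ ?_ hp')
    · exact hg.locallyIntegrable_grad.aestronglyMeasurable
    · exact hk.locallyIntegrable_grad.aestronglyMeasurable
  · rw [seminormW_of_ne hs hp, seminormW_of_ne hs hp, seminormW_of_ne hs hp, ← mul_add]
    gcongr
    have : quot n s p (u + v) = quot n s p u + quot n s p v := by
      funext z; simp only [quot, Pi.add_apply]; ring
    rw [this]
    exact eLpNorm_add_le (quot_aesm hu) (quot_aesm hv) hp'

lemma seminormW_zero {n : ℕ} {s p : ℝ} (hp : 1 ≤ p) : seminormW n s p (0 : Rn n → ℝ) = 0 := by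
  by_cases hs : s = 1
  · simp only [seminormW, if_pos hs, gradientNorm]
    exact le_antisymm ((iInf₂_le 0 (isWeakGradient_zero n)).trans (by simp)) zero_le
  · rw [seminormW_of_ne hs hp]
    have : quot n s p (0 : Rn n → ℝ) = 0 := by funext z; simp [quot]
    simp [this]

lemma seminormW_smul_le {n : ℕ} {s p : ℝ} (hp : 1 ≤ p) (c : ℝ) (u : Rn n → ℝ) (hc : c ≠ 0) :
    seminormW n s p (c • u) ≤ ‖c‖ₑ * seminormW n s p u := by
  by_cases hs : s = 1
  · simp only [seminormW, if_pos hs, gradientNorm]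
    rw [ENNReal.mul_iInf_of_ne (by simpa using hc) (by simp)]
    refine le_iInf fun g => ?_
    rw [ENNReal.mul_iInf_of_ne (by simpa using hc) (by simp)]
    refine le_iInf fun hg => ?_
    exact (iInf₂_le (c • g) (hg.smul c)).trans (eLpNorm_const_smul_le)
  · rw [seminormW_of_ne hs hp, seminormW_of_ne hs hp, mul_left_comm]
    gcongr
    have : quot n s p (c • u) = c • quot n s p u := by
      funext z; simp only [quot, Pi.smul_apply, smul_eq_mul]; ring
    rw [this]
    exact eLpNorm_const_smul_le

lemma seminormW_smul {n : ℕ} {s p : ℝ} (hp : 1 ≤ p) (c : ℝ) (u : Rn n → ℝ) :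
    seminormW n s p (c • u) = ‖c‖ₑ * seminormW n s p u := by
  rcases eq_or_ne c 0 with rfl | hc
  · simp [seminormW_zero hp]
  refine le_antisymm (seminormW_smul_le hp c u hc) ?_
  have h := seminormW_smul_le (n := n) (s := s) hp c⁻¹ (c • u) (inv_ne_zero hc)
  rw [inv_smul_smul₀ hc] at h
  calc ‖c‖ₑ * seminormW n s p u ≤ ‖c‖ₑ * (‖c⁻¹‖ₑ * seminormW n s p (c • u)) := by gcongr
    _ = seminormW n s p (c • u) := by
      rw [← mul_assoc, ← enorm_mul, mul_inv_cancel₀ hc]; simp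

/-! ### Test functions have finite seminorm -/

lemma isWeakGradient_cc {n : ℕ} (φ : Cc n) : IsWeakGradient φ (gradient φ) := by
  have hg : Continuous (gradient φ) :=
    (InnerProductSpace.toDual ℝ (Rn n)).symm.continuous.comp
      (φ.contDiff.continuous_fderiv (by simp))
  refine ⟨φ.continuous.locallyIntegrable, hg.locallyIntegrable, fun ψ v => ?_⟩
  obtain ⟨h1, h2⟩ := cc_fderiv ψ v
  obtain ⟨h3, h4⟩ := cc_fderiv φ v
  have hd : ∀ θ : Cc n, Differentiable ℝ θ := fun θ => θ.contDiff.differentiable (by simp)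
  have e : ∀ x, inner ℝ (gradient φ x) v = fderiv ℝ φ x v := fun x => by
    simp [gradient, InnerProductSpace.toDual_symm_apply]
  simp only [e]
  exact integral_mul_fderiv_eq_neg_fderiv_mul_of_integrable
    (integrable_mul_cc h3.locallyIntegrable ψ.continuous ψ.hasCompactSupport)
    (integrable_mul_cc φ.continuous.locallyIntegrable h1 h2)
    (integrable_mul_cc φ.continuous.locallyIntegrable ψ.continuous ψ.hasCompactSupport)
    (fun x _ => hd φ x) (fun x _ => hd ψ x)

lemma gradientNorm_cc_lt_top {n : ℕ} (p : ℝ) (φ : Cc n) : gradientNorm n p φ < ∞ := by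
  have hg : Continuous (gradient φ) :=
    (InnerProductSpace.toDual ℝ (Rn n)).symm.continuous.comp
      (φ.contDiff.continuous_fderiv (by simp))
  have hc : HasCompactSupport (gradient φ) :=
    (φ.hasCompactSupport.fderiv ℝ).comp_left (g := (InnerProductSpace.toDual ℝ (Rn n)).symm)
      (map_zero _)
  exact (iInf₂_le _ (isWeakGradient_cc φ)).trans_lt
    (hg.memLp_of_hasCompactSupport hc).eLpNorm_lt_top

/-- The radial majorant `min(L|h|, M)^p / |h|^(n + s p)` is integrable. -/
lemma lintegral_majorant {n : ℕ} (hn : 1 ≤ n) {s p L M : ℝ} (hs0 : 0 < s) (hs1 : s < 1)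
    (hp : 1 ≤ p) (hL : 0 ≤ L) (hM : 0 ≤ M) :
    ∫⁻ h : Rn n, ENNReal.ofReal (min (L * ‖h‖) M ^ p / ‖h‖ ^ ((n : ℝ) + s * p)) < ∞ := by
  have hp0 : 0 < p := by linarith
  have hsp : 0 < s * p := by positivity
  have hfr : Module.finrank ℝ (Rn n) = n := by simp
  have hmeas : Measurable fun h : Rn n => min (L * ‖h‖) M ^ p / ‖h‖ ^ ((n : ℝ) + s * p) := by
    fun_prop
  rw [← lintegral_add_compl _ (measurableSet_ball (x := (0 : Rn n)) (ε := 1))]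
  refine ENNReal.add_lt_top.2 ⟨?_, ?_⟩
  · have hint := integrableOn_ball_of_norm_le_rpow (μ := (volume : Measure (Rn n)))
      (by rw [hfr]; exact hn)
      (f := fun h : Rn n => min (L * ‖h‖) M ^ p / ‖h‖ ^ ((n : ℝ) + s * p)) (C := L ^ p)
      (α := (n : ℝ) + s * p - p) (r := 1) (by rw [hfr]; nlinarith)
      (Filter.Eventually.of_forall fun h => ?_) hmeas.aestronglyMeasurable
    · refine lt_of_le_of_lt (lintegral_mono fun h => ?_) hint.2
      rw [← ofReal_norm]
      exact ENNReal.ofReal_le_ofReal (Real.le_norm_self _)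
    · have h0 : 0 ≤ ‖h‖ := norm_nonneg h
      rw [Real.norm_of_nonneg (by positivity)]
      rcases h0.eq_or_lt with hh | hh
      · have e : min (L * ‖h‖) M ^ p = 0 := by
          rw [← hh, mul_zero, min_eq_left hM, Real.zero_rpow hp0.ne']
        rw [e, zero_div]; positivity
      · calc min (L * ‖h‖) M ^ p / ‖h‖ ^ ((n : ℝ) + s * p)
            ≤ (L * ‖h‖) ^ p / ‖h‖ ^ ((n : ℝ) + s * p) := by
              gcongr; exact min_le_left _ _
          _ = L ^ p * ‖h‖ ^ (-((n : ℝ) + s * p - p)) := by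
              rw [Real.mul_rpow hL h0, mul_div_assoc, ← Real.rpow_sub hh]
              congr 2; ring
  · have hfar := finite_integral_one_add_norm (μ := (volume : Measure (Rn n)))
      (r := (n : ℝ) + s * p) (by rw [hfr]; linarith)
    have hbd : ∀ h ∈ (Metric.ball (0 : Rn n) 1)ᶜ,
        ENNReal.ofReal (min (L * ‖h‖) M ^ p / ‖h‖ ^ ((n : ℝ) + s * p)) ≤
        ENNReal.ofReal (M ^ p * 2 ^ ((n : ℝ) + s * p)) *
          ENNReal.ofReal ((1 + ‖h‖) ^ (-((n : ℝ) + s * p))) := by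
      intro h hh
      have h1 : 1 ≤ ‖h‖ := by simpa using hh
      have h0 : 0 < ‖h‖ := by linarith
      rw [← ENNReal.ofReal_mul (by positivity)]
      refine ENNReal.ofReal_le_ofReal ?_
      rw [Real.rpow_neg (by positivity), ← div_eq_mul_inv, div_le_div_iff₀ (by positivity)
        (by positivity)]
      calc min (L * ‖h‖) M ^ p * (1 + ‖h‖) ^ ((n : ℝ) + s * p)
          ≤ M ^ p * (2 * ‖h‖) ^ ((n : ℝ) + s * p) := by
            gcongr
            · exact min_le_right _ _
            · linarith
        _ = M ^ p * 2 ^ ((n : ℝ) + s * p) * ‖h‖ ^ ((n : ℝ) + s * p) := by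
            rw [Real.mul_rpow (by norm_num) h0.le]; ring
    refine (setLIntegral_mono' measurableSet_ball.compl hbd).trans_lt ?_
    refine (setLIntegral_le_lintegral _ _).trans_lt ?_
    rw [lintegral_const_mul' _ _ ENNReal.ofReal_ne_top]
    exact ENNReal.mul_lt_top ENNReal.ofReal_lt_top hfar

lemma gagliardoEnergy_cc_lt_top {n : ℕ} {s p : ℝ} (hs0 : 0 < s) (hs1 : s < 1) (hp : 1 ≤ p)
    (φ : Cc n) : gagliardoEnergy n s p φ < ∞ := by
  have hp0 : 0 < p := by linarith
  rcases Nat.eq_zero_or_pos n with rfl | hn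
  · have : ∀ x y : Rn 0, φ x = φ y := fun x y => by rw [Subsingleton.elim x y]
    have h0 : gagliardoEnergy 0 s p φ = ∫⁻ z : Rn 0 × Rn 0, 0 := by
      refine lintegral_congr fun z => ?_
      rw [this z.1 z.2, sub_self, abs_zero, Real.zero_rpow hp0.ne', zero_div, ENNReal.ofReal_zero]
    rw [h0]; simp
  obtain ⟨L, hL⟩ := φ.contDiff.lipschitzWith_of_hasCompactSupport φ.hasCompactSupport (by simp)
  obtain ⟨B, hB⟩ := φ.continuous.bounded_above_of_compact_support φ.hasCompactSupport
  have hB0 : 0 ≤ B := (norm_nonneg _).trans (hB 0)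
  set k : Rn n → ℝ≥0∞ := fun h =>
    ENNReal.ofReal (min (L * ‖h‖) (2 * B) ^ p / ‖h‖ ^ ((n : ℝ) + s * p)) with hk
  have hkm : Measurable k := by fun_prop
  have hkfin : ∫⁻ h, k h < ∞ :=
    lintegral_majorant hn hs0 hs1 hp L.2 (by positivity)
  set K := tsupport φ with hK
  have hKm : MeasurableSet K := (isClosed_tsupport _).measurableSet
  have hKfin : volume K < ∞ := φ.hasCompactSupport.isCompact.measure_lt_top
  set i : Rn n → ℝ≥0∞ := K.indicator 1 with hi
  have him : Measurable i := measurable_one.indicator hKm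
  have hiint : ∫⁻ x, i x = volume K := by rw [hi, lintegral_indicator_one hKm]
  have hbd : ∀ z : Rn n × Rn n,
      ENNReal.ofReal (|φ z.1 - φ z.2| ^ p / ‖z.1 - z.2‖ ^ ((n : ℝ) + s * p)) ≤
        i z.1 * k (z.1 - z.2) + i z.2 * k (z.1 - z.2) := by
    intro z
    rw [← add_mul]
    by_cases h1 : z.1 ∈ K ∨ z.2 ∈ K
    · have hone : 1 ≤ i z.1 + i z.2 := by
        rcases h1 with h | h
        · exact le_add_right (by simp [hi, h])
        · exact le_add_left (by simp [hi, h])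
      refine le_trans ?_ (le_mul_of_one_le_left zero_le hone)
      refine ENNReal.ofReal_le_ofReal ?_
      gcongr
      refine le_min ?_ ?_
      · simpa [Real.dist_eq, dist_eq_norm] using hL.dist_le_mul z.1 z.2
      · have := norm_sub_le (φ z.1) (φ z.2)
        rw [Real.norm_eq_abs] at this
        linarith [hB z.1, hB z.2]
    · push Not at h1
      rw [image_eq_zero_of_notMem_tsupport h1.1, image_eq_zero_of_notMem_tsupport h1.2]
      simp [Real.zero_rpow hp0.ne']
  have hm1 : Measurable fun z : Rn n × Rn n => i z.1 * k (z.1 - z.2) := by fun_prop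
  have hm2 : Measurable fun z : Rn n × Rn n => i z.2 * k (z.1 - z.2) := by fun_prop
  refine (lintegral_mono hbd).trans_lt ?_
  rw [lintegral_add_left hm1, Measure.volume_eq_prod, lintegral_prod _ hm1.aemeasurable,
    lintegral_prod_symm _ hm2.aemeasurable]
  have e1 : ∀ x : Rn n, ∫⁻ y, i x * k (x - y) = i x * ∫⁻ h, k h := fun x => by
    rw [lintegral_const_mul _ (by fun_prop), lintegral_sub_left_eq_self k x]
  have e2 : ∀ y : Rn n, ∫⁻ x, i y * k (x - y) = i y * ∫⁻ h, k h := fun y => by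
    rw [lintegral_const_mul _ (by fun_prop), lintegral_sub_right_eq_self k y]
  simp only [e1, e2]
  rw [lintegral_mul_const _ him, hiint]
  exact ENNReal.add_lt_top.2 ⟨ENNReal.mul_lt_top hKfin hkfin, ENNReal.mul_lt_top hKfin hkfin⟩

lemma seminormW_cc_lt_top {n : ℕ} {s p : ℝ} (hs0 : 0 < s) (hs1 : s ≤ 1) (hp : 1 ≤ p)
    (φ : Cc n) : seminormW n s p φ < ∞ := by
  by_cases hs : s = 1
  · rw [seminormW, if_pos hs]
    exact gradientNorm_cc_lt_top p φ
  · rw [seminormW, if_neg hs]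
    exact ENNReal.rpow_lt_top_of_nonneg (by positivity) (ENNReal.mul_lt_top
      ENNReal.ofReal_lt_top (gagliardoEnergy_cc_lt_top hs0 (lt_of_le_of_ne hs1 hs) hp φ)).ne

/-! ### The space `C_c^∞(ℝⁿ)` with the seminorm `[·]_{W^{s,p}}`, and its completion -/

/-- A copy of `C_c^∞(ℝⁿ)`, to be equipped with the seminorm `[·]_{W^{s,p}(ℝⁿ)}` instead of the
usual topology on test functions. -/
def TestW (n : ℕ) (s p : ℝ) (_hs0 : 0 < s) (_hs1 : s ≤ 1) (_hp : 1 ≤ p) : Type := Cc n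

namespace TestW

variable {n : ℕ} {s p : ℝ} {hs0 : 0 < s} {hs1 : s ≤ 1} {hp : 1 ≤ p}

instance : AddCommGroup (TestW n s p hs0 hs1 hp) := inferInstanceAs (AddCommGroup (Cc n))

instance : Module ℝ (TestW n s p hs0 hs1 hp) := inferInstanceAs (Module ℝ (Cc n))

/-- The underlying function on `ℝⁿ`. -/
def toFun (φ : TestW n s p hs0 hs1 hp) : Rn n → ℝ := TestFunction.toFun φ

/-- The norm is the Gagliardo–Slobodeckiĭ seminorm (which is finite on test functions). -/
instance : Norm (TestW n s p hs0 hs1 hp) := ⟨fun φ => (seminormW n s p φ.toFun).toReal⟩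

lemma norm_def (φ : TestW n s p hs0 hs1 hp) : ‖φ‖ = (seminormW n s p φ.toFun).toReal := rfl

lemma toFun_add (φ ψ : TestW n s p hs0 hs1 hp) : (φ + ψ).toFun = φ.toFun + ψ.toFun := rfl

lemma toFun_smul (c : ℝ) (φ : TestW n s p hs0 hs1 hp) : (c • φ).toFun = c • φ.toFun := rfl

lemma continuous_toFun (φ : TestW n s p hs0 hs1 hp) : Continuous φ.toFun :=
  TestFunction.continuous (show Cc n from φ)

lemma seminormW_lt_top (φ : TestW n s p hs0 hs1 hp) : seminormW n s p φ.toFun < ∞ :=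
  seminormW_cc_lt_top hs0 hs1 hp (show Cc n from φ)

lemma core : SeminormedSpace.Core ℝ (TestW n s p hs0 hs1 hp) where
  norm_nonneg _ := ENNReal.toReal_nonneg
  norm_smul c φ := by
    rw [norm_def, norm_def, toFun_smul, seminormW_smul hp, ENNReal.toReal_mul, toReal_enorm]
  norm_triangle φ ψ := by
    rw [norm_def, norm_def, norm_def, toFun_add,
      ← ENNReal.toReal_add (seminormW_lt_top φ).ne (seminormW_lt_top ψ).ne]
    exact ENNReal.toReal_mono
      (ENNReal.add_ne_top.2 ⟨(seminormW_lt_top φ).ne, (seminormW_lt_top ψ).ne⟩)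
      (seminormW_add_le hp φ.continuous_toFun.aestronglyMeasurable
        ψ.continuous_toFun.aestronglyMeasurable)

instance : SeminormedAddCommGroup (TestW n s p hs0 hs1 hp) := SeminormedAddCommGroup.ofCore core

instance : NormedSpace ℝ (TestW n s p hs0 hs1 hp) where
  norm_smul_le c φ := (core.norm_smul c φ).le

end TestW

/-- `𝒟^{s,p}(ℝⁿ)`: the completion of `C_c^∞(ℝⁿ)` with respect to `[·]_{W^{s,p}(ℝⁿ)}`. -/
abbrev SpaceD (n : ℕ) (s p : ℝ) (hs0 : 0 < s) (hs1 : s ≤ 1) (hp : 1 ≤ p) : Type :=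
  UniformSpace.Completion (TestW n s p hs0 hs1 hp)

/-! ### The space `Ẇ^{s,p}(ℝⁿ)` in the subcritical range -/

/-- The critical Sobolev exponent `n p / (n - s p)`. -/
def critExp (n : ℕ) (s p : ℝ) : ℝ≥0∞ := ENNReal.ofReal ((n : ℝ) * p / ((n : ℝ) - s * p))

/-- `{u ∈ L^{n p / (n - s p)}(ℝⁿ) : [u]_{W^{s,p}(ℝⁿ)} < ∞}` as a linear subspace (functions are
identified when they agree almost everywhere). -/
def dotWSubmodule (n : ℕ) (s p : ℝ) (hp : 1 ≤ p) :
    Submodule ℝ (Lp ℝ (critExp n s p) (volume : Measure (Rn n))) where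
  carrier := {u | seminormW n s p u < ∞}
  zero_mem' := by
    rw [mem_ofPred_eq, seminormW_congr hp (Lp.coeFn_zero _ _ _), seminormW_zero hp]
    exact ENNReal.zero_lt_top
  add_mem' {u v} hu hv := by
    rw [mem_ofPred_eq, seminormW_congr hp (Lp.coeFn_add u v)]
    exact (seminormW_add_le hp (Lp.aestronglyMeasurable u) (Lp.aestronglyMeasurable v)).trans_lt
      (ENNReal.add_lt_top.2 ⟨hu, hv⟩)
  smul_mem' c u hu := by
    rw [mem_ofPred_eq, seminormW_congr hp (Lp.coeFn_smul c u), seminormW_smul hp]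
    exact ENNReal.mul_lt_top enorm_lt_top hu

/-- `Ẇ^{s,p}(ℝⁿ)`: a copy of the subspace above, to be normed by `[·]_{W^{s,p}(ℝⁿ)}` instead of
the `L^q` norm. -/
def DotW (n : ℕ) (s p : ℝ) (hp : 1 ≤ p) : Type := dotWSubmodule n s p hp

namespace DotW

variable {n : ℕ} {s p : ℝ} {hp : 1 ≤ p}

instance : AddCommGroup (DotW n s p hp) := inferInstanceAs (AddCommGroup (dotWSubmodule n s p hp))

instance : Module ℝ (DotW n s p hp) := inferInstanceAs (Module ℝ (dotWSubmodule n s p hp))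

/-- The underlying element of `L^q(ℝⁿ)`, `q = n p / (n - s p)`. -/
def toLp (u : DotW n s p hp) : Lp ℝ (critExp n s p) (volume : Measure (Rn n)) :=
  Subtype.val (p := fun v => v ∈ dotWSubmodule n s p hp) u

/-- The norm is the Gagliardo–Slobodeckiĭ seminorm (finite by definition of the space). -/
instance : Norm (DotW n s p hp) := ⟨fun u => (seminormW n s p u.toLp).toReal⟩

lemma norm_def (u : DotW n s p hp) : ‖u‖ = (seminormW n s p u.toLp).toReal := rfl

lemma toLp_add (u v : DotW n s p hp) : (u + v).toLp = u.toLp + v.toLp := rfl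

lemma toLp_smul (c : ℝ) (u : DotW n s p hp) : (c • u).toLp = c • u.toLp := rfl

lemma toLp_injective : Function.Injective (toLp : DotW n s p hp → _) := Subtype.val_injective

lemma seminormW_lt_top (u : DotW n s p hp) : seminormW n s p u.toLp < ∞ :=
  Subtype.property (p := fun v => v ∈ dotWSubmodule n s p hp) u

lemma core : SeminormedSpace.Core ℝ (DotW n s p hp) where
  norm_nonneg _ := ENNReal.toReal_nonneg
  norm_smul c u := by
    rw [norm_def, norm_def, toLp_smul, seminormW_congr hp (Lp.coeFn_smul c u.toLp),
      seminormW_smul hp, ENNReal.toReal_mul, toReal_enorm]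
  norm_triangle u v := by
    rw [norm_def, norm_def, norm_def, toLp_add, seminormW_congr hp (Lp.coeFn_add u.toLp v.toLp),
      ← ENNReal.toReal_add (seminormW_lt_top u).ne (seminormW_lt_top v).ne]
    exact ENNReal.toReal_mono
      (ENNReal.add_ne_top.2 ⟨(seminormW_lt_top u).ne, (seminormW_lt_top v).ne⟩)
      (seminormW_add_le hp (Lp.aestronglyMeasurable _) (Lp.aestronglyMeasurable _))

/-- Only the axioms of a seminorm are recorded here; definiteness is not part of this instance. -/
instance : SeminormedAddCommGroup (DotW n s p hp) := SeminormedAddCommGroup.ofCore core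

instance : NormedSpace ℝ (DotW n s p hp) where
  norm_smul_le c u := (core.norm_smul c u).le

end DotW

variable {n : ℕ} {s p : ℝ} {hs0 : 0 < s} {hs1 : s ≤ 1} {hp : 1 ≤ p}

lemma TestW.memLp (φ : TestW n s p hs0 hs1 hp) (q : ℝ≥0∞) : MemLp φ.toFun q volume :=
  φ.continuous_toFun.memLp_of_hasCompactSupport
    (TestFunction.hasCompactSupport (show Cc n from φ))

/-- The inclusion `C_c^∞(ℝⁿ) ⊆ Ẇ^{s,p}(ℝⁿ)`: a test function is sent to its class in `L^q`. -/
def incl (n : ℕ) (s p : ℝ) (hs0 : 0 < s) (hs1 : s ≤ 1) (hp : 1 ≤ p) :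
    TestW n s p hs0 hs1 hp →ₗᵢ[ℝ] DotW n s p hp where
  toFun φ := (⟨(φ.memLp (critExp n s p)).toLp φ.toFun, by
    change seminormW n s p _ < ∞
    rw [seminormW_congr hp (MemLp.coeFn_toLp _)]
    exact φ.seminormW_lt_top⟩ : dotWSubmodule n s p hp)
  map_add' φ ψ := rfl
  map_smul' c φ := rfl
  norm_map' φ := by
    rw [DotW.norm_def, TestW.norm_def]
    exact congrArg ENNReal.toReal
      (seminormW_congr hp (MemLp.coeFn_toLp (φ.memLp (critExp n s p))))

end HomSobolev

end

/-!
Write `q = n p / (n - s p)` for the critical exponent. Everything rests on two facts about a function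
`u ∈ L^q` with `[u]_{W^{s,p}} < ∞`.

* The Sobolev inequality `‖u‖_q ≤ C [u]_{W^{s,p}}` (`exists_eLpNorm_le_mul_seminormW`). For `s < 1`
  it has a short proof that applies to `u` directly: averaging `|u x| ≤ |u x - u y| + |u y|` over
  `y ∈ B(x, r)` and optimizing in `r` gives `|u x| ^ q ≤ K ‖u‖_q ^ (q - p) D x ^ p`, where
  `D x ^ p = ∫ |u x - u y| ^ p / |x - y| ^ (n + s p) dy`; then one integrates in `x`
  (`exists_eLpNorm_le_mul_eLpNorm_quot`). For `s = 1` it is the Gagliardo–Nirenberg–Sobolev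
  inequality for test functions, extended by density (`exists_eLpNorm_le_mul_gradient`).
* Density of test functions (`exists_test_seminormW_sub_le`), by truncation and mollification. A
  mollification converges because translations are continuous in `L^p`
  (`exists_eLpNorm_mollify_sub_le`); for `s < 1` this is used on `ℝⁿ × ℝⁿ`, where the difference
  quotient of a mollification is an average of diagonal translates of the difference quotient. For
  `s = 1` the truncation error `u ∇η` is handled by Hölder's inequality, `∇η` being bounded in
  `L^n` at all scales. For `s < 1` the small values of `u` are removed beforehand, which puts the
  function in `L^p` and makes the truncation error a convolution that tends to zero.

The Sobolev inequality shows that the seminorm is definite on `Ẇ^{s,p}` and that Cauchy sequences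
of `Ẇ^{s,p}` converge in `L^q`. Since the weak gradient and the difference quotient are closed
operators, `Ẇ^{s,p}` is complete. A separated complete space that contains the test functions
densely and isometrically is their completion (`exists_linearIsometryEquiv_completion`).
-/

open Filter Topology

namespace HomSobolev

/-! ### Averages over small translations converge in `L^p` -/

section Mollification

variable {V W E : Type*} [NormedAddCommGroup V] [NormedSpace ℝ V] [FiniteDimensional ℝ V]
  [MeasurableSpace V] [BorelSpace V] {μ : Measure V} [μ.IsAddHaarMeasure]
  [NormedAddCommGroup E] {p : ℝ≥0∞}

/-- Translations act continuously on `L^p`. The translation vector is parametrized by a map `ι` so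
that the diagonal translations `(x, y) ↦ (x - h, y - h)` of `ℝⁿ × ℝⁿ` are covered; these are the
ones that commute with forming the difference quotient `quot`. -/
theorem tendsto_eLpNorm_translate_sub [TopologicalSpace W] (hp1 : 1 ≤ p) (hp : p ≠ ∞)
    {ι : W → V} (hι : Continuous ι) {w₀ : W} (h0 : ι w₀ = 0) {F : V → E} (hF : MemLp F p μ) :
    Tendsto (fun h => eLpNorm (fun z => F (z - ι h) - F z) p μ) (𝓝 w₀) (𝓝 0) := by
  have : Fact (1 ≤ p) := ⟨hp1⟩
  let g : W → C(V, V) := fun h => ⟨fun z => z - ι h, by fun_prop⟩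
  have hg : Continuous g :=
    ContinuousMap.continuous_of_continuous_uncurry _ (show Continuous fun x : W × V => x.2 - ι x.1 by fun_prop)
  have hgm : ∀ h, MeasurePreserving (g h) μ μ := fun h => measurePreserving_sub_right μ (ι h)
  have key := (continuous_const (y := hF.toLp F)).compMeasurePreservingLp hg hgm hp
  have key2 := (key.tendsto w₀).sub_const (hF.toLp F)
  have e0 : Lp.compMeasurePreserving (g w₀) (hgm w₀) (hF.toLp F) = hF.toLp F := by
    refine Lp.ext ((Lp.coeFn_compMeasurePreserving _ _).trans ?_)
    refine Eventually.of_forall fun z => ?_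
    simp [g, h0]
  rw [e0, sub_self] at key2
  have key3 := (continuous_enorm.tendsto _).comp key2
  rw [enorm_zero] at key3
  refine key3.congr fun h => ?_
  simp only [Function.comp, Lp.enorm_def]
  refine eLpNorm_congr_ae ?_
  have a1 := Lp.coeFn_compMeasurePreserving (hF.toLp F) (hgm h)
  have a2 : (hF.toLp F) ∘ (g h) =ᵐ[μ] F ∘ (g h) :=
    (hgm h).quasiMeasurePreserving.ae_eq_comp hF.coeFn_toLp
  filter_upwards [Lp.coeFn_sub (Lp.compMeasurePreserving (g h) (hgm h) (hF.toLp F)) (hF.toLp F),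
    a1, a2, hF.coeFn_toLp] with z h1 h2 h3 h4
  rw [h1, Pi.sub_apply, h2, h3, h4]
  rfl

/-- Averaging the translates of `F` against a probability measure moves `F` in `L^p` by no more than
the translates themselves do: Jensen's inequality at each point, then Tonelli. -/
theorem eLpNorm_average_translate_sub_le [MeasurableSpace W] {ν : Measure W}
    [IsProbabilityMeasure ν] [NormedSpace ℝ E] [CompleteSpace E] (hp1 : 1 ≤ p) (hp : p ≠ ∞)
    {ι : W → V} (hι : Measurable ι) {F : V → E} (hF : StronglyMeasurable F)
    {δ : ℝ≥0∞} (hδ : δ ≠ ∞) (h : ∀ᵐ h ∂ν, eLpNorm (fun z => F (z - ι h) - F z) p μ ≤ δ) :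
    eLpNorm (fun z => (∫ h, F (z - ι h) ∂ν) - F z) p μ ≤ δ := by
  have hp0 : p ≠ 0 := (one_pos.trans_le hp1).ne'
  have hpr : 0 < p.toReal := ENNReal.toReal_pos hp0 hp
  have hm : StronglyMeasurable (fun x : V × W => F (x.1 - ι x.2) - F x.1) :=
    (hF.comp_measurable (by fun_prop)).sub (hF.comp_measurable measurable_fst)
  have hm' : Measurable (fun x : V × W => ‖F (x.1 - ι x.2) - F x.1‖ₑ ^ p.toReal) :=
    hm.enorm.pow_const _
  have hle : ∫⁻ z, ∫⁻ h, ‖F (z - ι h) - F z‖ₑ ^ p.toReal ∂ν ∂μ ≤ δ ^ p.toReal := by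
    rw [lintegral_lintegral_swap hm'.aemeasurable]
    calc _ ≤ ∫⁻ _h, δ ^ p.toReal ∂ν := by
          refine lintegral_mono_ae (h.mono fun h hh => ?_)
          rw [eLpNorm_eq_lintegral_rpow_enorm_toReal hp0 hp] at hh
          rwa [one_div, ENNReal.rpow_inv_le_iff hpr] at hh
      _ = _ := by simp
  -- Finiteness of the double integral makes `h ↦ F (z - ι h)` integrable for almost every `z`,
  -- so that the average is not a junk value there.
  have hfin : ∀ᵐ z ∂μ, ∫⁻ h, ‖F (z - ι h) - F z‖ₑ ^ p.toReal ∂ν < ∞ :=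
    ae_lt_top hm'.lintegral_prod_right' (hle.trans_lt (by finiteness)).ne
  have hpt : ∀ᵐ z ∂μ, ‖(∫ h, F (z - ι h) ∂ν) - F z‖ₑ ^ p.toReal
      ≤ ∫⁻ h, ‖F (z - ι h) - F z‖ₑ ^ p.toReal ∂ν := by
    filter_upwards [hfin] with z hz
    have hmz : StronglyMeasurable (fun h => F (z - ι h) - F z) :=
      hm.comp_measurable (by fun_prop : Measurable fun h : W => (z, h))
    have hL : MemLp (fun h => F (z - ι h) - F z) p ν := by
      refine ⟨hmz.aestronglyMeasurable, ?_⟩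
      rwa [eLpNorm_lt_top_iff_lintegral_rpow_enorm_lt_top hp0 hp]
    have hI : Integrable (fun h => F (z - ι h) - F z) ν := hL.integrable hp1
    have hI' : Integrable (fun h => F (z - ι h)) ν := by
      exact (hI.add (integrable_const (F z))).congr (Eventually.of_forall fun h => by simp)
    have e : (∫ h, F (z - ι h) ∂ν) - F z = ∫ h, (F (z - ι h) - F z) ∂ν := by
      rw [integral_sub hI' (integrable_const _)]; simp
    rw [e, ← ENNReal.le_rpow_inv_iff hpr, ← one_div, ← eLpNorm_eq_lintegral_rpow_enorm_toReal hp0 hp]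
    refine (enorm_integral_le_lintegral_enorm _).trans ?_
    rw [← eLpNorm_one_eq_lintegral_enorm]
    exact eLpNorm_le_eLpNorm_of_exponent_le hp1 hmz.aestronglyMeasurable
  rw [eLpNorm_eq_lintegral_rpow_enorm_toReal hp0 hp, one_div, ENNReal.rpow_inv_le_iff hpr]
  exact (lintegral_mono_ae hpt).trans hle

theorem exists_eLpNorm_mollify_sub_le [NormedSpace ℝ E] [CompleteSpace E] {n : ℕ} (hp1 : 1 ≤ p)
    (hp : p ≠ ∞) {ι : Rn n → V} (hι : Continuous ι) (h0 : ι 0 = 0) {F : V → E}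
    (hF : StronglyMeasurable F) (hFp : MemLp F p μ) {δ : ℝ≥0∞} (hδ : δ ≠ 0) :
    ∃ r > 0, ∀ φ : ContDiffBump (0 : Rn n), φ.rOut < r →
      eLpNorm (fun z => (∫ h, φ.normed volume h • F (z - ι h)) - F z) p μ ≤ δ := by
  wlog hδ' : δ ≠ ∞ generalizing δ
  · obtain ⟨r, hr, h⟩ := this one_ne_zero ENNReal.one_ne_top
    rw [not_not] at hδ'
    exact ⟨r, hr, fun φ _ => hδ' ▸ le_top⟩
  have hev := (tendsto_eLpNorm_translate_sub hp1 hp hι h0 hFp).eventually_le_const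
    (pos_iff_ne_zero.2 hδ)
  obtain ⟨r, hr, hball⟩ := Metric.eventually_nhds_iff.1 hev
  refine ⟨r, hr, fun φ hφ => ?_⟩
  set ρ : Rn n → ℝ≥0∞ := fun h => ENNReal.ofReal (φ.normed volume h) with hρ
  have hρm : Measurable ρ := φ.continuous_normed.measurable.ennreal_ofReal
  set ν : Measure (Rn n) := volume.withDensity ρ with hν
  have hprob : IsProbabilityMeasure ν := by
    refine ⟨?_⟩
    rw [hν, withDensity_apply _ MeasurableSet.univ, Measure.restrict_univ, hρ,
      ← ofReal_integral_eq_lintegral_ofReal φ.integrable_normed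
        (Eventually.of_forall φ.nonneg_normed), φ.integral_normed, ENNReal.ofReal_one]
  have hae : ∀ᵐ h ∂ν, eLpNorm (fun z => F (z - ι h) - F z) p μ ≤ δ := by
    rw [hν, ae_withDensity_iff hρm]
    refine Eventually.of_forall fun h hh => hball ?_
    have : h ∈ Function.support (φ.normed volume) := by
      intro h0
      exact hh (by simp [hρ, h0])
    rw [φ.support_normed_eq] at this
    exact (Metric.mem_ball.1 this).trans hφ
  have := eLpNorm_average_translate_sub_le hp1 hp hι.measurable hF hδ' hae
  refine le_of_eq_of_le ?_ this
  congr 1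
  funext z
  rw [hν, integral_withDensity_eq_integral_toReal_smul hρm (by simp [hρ])]
  simp [hρ, ENNReal.toReal_ofReal (φ.nonneg_normed _)]

end Mollification

/-! ### The fractional Sobolev inequality -/

/-- Optimization of a pointwise bound over the radius: the power of `r` is chosen so that the second
term equals `t / 2`. -/
theorem rpow_le_of_forall_radius {c₁ c₂ s θ p q a : ℝ} (hc₁ : 0 < c₁) (hc₂ : 0 < c₂)
    (hθ : 0 < θ) (hp : 0 < p) (hq : q = p + s / θ * p) (ha : 0 < a) {t d : ℝ}
    (ht : 0 ≤ t) (hd : 0 ≤ d) (hq0 : 0 < q)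
    (h : ∀ r > 0, t ≤ c₁ * d * r ^ s + c₂ * a * r ^ (-θ)) :
    t ^ q ≤ (2 * c₁) ^ p * (2 * c₂) ^ (q - p) * a ^ (q - p) * d ^ p := by
  rcases ht.eq_or_lt with rfl | ht
  · rw [Real.zero_rpow hq0.ne']; positivity
  have hX : 0 < 2 * c₂ * a / t := by positivity
  have h1 := h ((2 * c₂ * a / t) ^ (1 / θ)) (by positivity)
  rw [← Real.rpow_mul hX.le, ← Real.rpow_mul hX.le] at h1
  have e1 : 1 / θ * -θ = -1 := by field_simp
  have e2 : c₂ * a * (2 * c₂ * a / t) ^ (-1 : ℝ) = t / 2 := by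
    rw [Real.rpow_neg_one]; field_simp
  rw [e1, e2, one_div_mul_eq_div, Real.div_rpow (by positivity) ht.le] at h1
  have hts : 0 < t ^ (s / θ) := by positivity
  have h2 : t * t ^ (s / θ) ≤ 2 * c₁ * d * (2 * c₂ * a) ^ (s / θ) := by
    have : t ≤ 2 * c₁ * d * (2 * c₂ * a) ^ (s / θ) / t ^ (s / θ) := by
      have : c₁ * d * ((2 * c₂ * a) ^ (s / θ) / t ^ (s / θ)) * 2 =
        2 * c₁ * d * (2 * c₂ * a) ^ (s / θ) / t ^ (s / θ) := by ring
      linarith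
    rwa [le_div_iff₀ hts] at this
  have h3 := Real.rpow_le_rpow (by positivity) h2 hp.le
  have e3 : s / θ * p = q - p := by linarith
  rw [Real.mul_rpow ht.le hts.le, ← Real.rpow_mul ht.le, e3, ← Real.rpow_add ht,
    Real.mul_rpow (by positivity) (by positivity), ← Real.rpow_mul (by positivity), e3,
    Real.mul_rpow (by positivity) hd, Real.mul_rpow (by positivity) ha.le] at h3
  have e4 : p + (q - p) = q := by ring
  rw [e4] at h3
  linarith

/-- Averaging `|u x| ≤ |u x - u y| + |u y|` over `y` in the ball `B(x, r)` and applying Hölder's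
inequality to both terms. -/
theorem mul_volume_ball_le {n : ℕ} {s p : ℝ} (hs0 : 0 < s) (hp : 1 ≤ p) {q : ℝ≥0∞} (hq : 1 ≤ q)
    {u : Rn n → ℝ} (hu : StronglyMeasurable u) (x : Rn n) {r : ℝ} (hr : 0 < r) :
    ‖u x‖ₑ * volume (Metric.ball x r) ≤
      ENNReal.ofReal (r ^ ((n : ℝ) / p + s)) *
        (eLpNorm (fun y => quot n s p u (x, y)) (ENNReal.ofReal p) volume *
          volume (Metric.ball x r) ^ (1 - 1 / p)) +
      eLpNorm u q volume * volume (Metric.ball x r) ^ (1 - 1 / q.toReal) := by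
  have hp0 : 0 < p := by linarith
  set B := Metric.ball x r with hB
  have hQ : StronglyMeasurable fun y => quot n s p u (x, y) := by
    have h3 : Measurable fun y : Rn n => (‖x - y‖ ^ ((n : ℝ) / p + s))⁻¹ := by fun_prop
    exact h3.stronglyMeasurable.mul ((stronglyMeasurable_const (b := u x)).sub hu)
  have hJ : ∀ {q : ℝ≥0∞} (_ : 1 ≤ q) {f : Rn n → ℝ} (_ : StronglyMeasurable f),
      ∫⁻ y in B, ‖f y‖ₑ ≤ eLpNorm f q volume * volume B ^ (1 - 1 / q.toReal) := by
    intro q hq f hf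
    rw [← eLpNorm_one_eq_lintegral_enorm]
    refine (eLpNorm_le_eLpNorm_mul_rpow_measure_univ hq hf.aestronglyMeasurable).trans ?_
    rw [Measure.restrict_apply_univ, ENNReal.toReal_one, div_one]
    gcongr
    exact Measure.restrict_le_self
  have h1 : ∀ y ∈ B, ‖u x‖ₑ ≤
      ENNReal.ofReal (r ^ ((n : ℝ) / p + s)) * ‖quot n s p u (x, y)‖ₑ + ‖u y‖ₑ := by
    intro y hy
    have e : ‖u x‖ₑ ≤ ‖u x - u y‖ₑ + ‖u y‖ₑ := by
      simpa using enorm_add_le (u x - u y) (u y)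
    refine e.trans ?_
    gcongr
    rw [← ofReal_norm, ← ofReal_norm, ← ENNReal.ofReal_mul (p := r ^ ((n : ℝ) / p + s)) (by positivity)]
    refine ENNReal.ofReal_le_ofReal ?_
    rw [quot, norm_mul, norm_inv,
      Real.norm_of_nonneg (Real.rpow_nonneg (norm_nonneg (x - y)) ((n : ℝ) / p + s))]
    rcases eq_or_ne x y with rfl | hxy
    · simp
    have hpos : 0 < ‖x - y‖ := norm_pos_iff.2 (sub_ne_zero.2 hxy)
    have hle : ‖x - y‖ ≤ r := by
      rw [← dist_eq_norm, dist_comm]; exact (Metric.mem_ball.1 hy).le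
    rw [← mul_assoc, ← div_eq_mul_inv]
    refine le_mul_of_one_le_left (norm_nonneg (u x - u y)) ?_
    rw [one_le_div (by positivity)]
    gcongr
  calc ‖u x‖ₑ * volume B = ∫⁻ _y in B, ‖u x‖ₑ := by simp
    _ ≤ ∫⁻ y in B, (ENNReal.ofReal (r ^ ((n : ℝ) / p + s)) * ‖quot n s p u (x, y)‖ₑ + ‖u y‖ₑ) :=
        setLIntegral_mono' measurableSet_ball h1
    _ = ENNReal.ofReal (r ^ ((n : ℝ) / p + s)) * (∫⁻ y in B, ‖quot n s p u (x, y)‖ₑ) +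
        ∫⁻ y in B, ‖u y‖ₑ := by
        rw [lintegral_add_right _ hu.enorm, lintegral_const_mul _ hQ.enorm]
    _ ≤ _ := by
        gcongr
        · have := hJ (q := ENNReal.ofReal p) (by simpa using hp) hQ
          rwa [ENNReal.toReal_ofReal hp0.le] at this
        · exact hJ hq hu

/-- The fractional Sobolev inequality, for every function of `L^q`, where `q = n p / (n - s p)`.
With `D x = ‖quot u (x, ·)‖_p`, the bound
`|u x| ≤ c₁ D x r ^ s + c₂ ‖u‖_q r ^ (-n / q)` for all `r > 0` gives
`|u x| ^ q ≤ K ‖u‖_q ^ (q - p) D x ^ p`. Integrating in `x` and dividing by `‖u‖_q ^ (q - p)`,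
which is finite by assumption, gives the claim. -/
theorem exists_eLpNorm_le_mul_eLpNorm_quot {n : ℕ} {s p : ℝ} (hs0 : 0 < s) (hp : 1 ≤ p)
    (hsp : s * p < n) : ∃ C : ℝ≥0∞, C ≠ ∞ ∧ ∀ u : Rn n → ℝ, StronglyMeasurable u →
      MemLp u (critExp n s p) volume →
      eLpNorm u (critExp n s p) volume ≤ C * eLpNorm (quot n s p u) (ENNReal.ofReal p) volume := by
  have hp0 : 0 < p := by linarith
  have hn0 : 0 < (n : ℝ) := by nlinarith [mul_pos hs0 hp0]
  have hns : 0 < (n : ℝ) - s * p := by linarith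
  set q : ℝ := (n : ℝ) * p / ((n : ℝ) - s * p) with hq
  have hpq : p ≤ q := by
    rw [hq, le_div_iff₀ hns]; nlinarith [mul_pos hs0 hp0]
  have hq0 : 0 < q := by linarith
  have hcrit : critExp n s p = ENNReal.ofReal q := rfl
  set b : ℝ := (volume (Metric.ball (0 : Rn n) 1)).toReal with hb
  have hb0 : 0 < b := ENNReal.toReal_pos (Metric.measure_ball_pos _ _ one_pos).ne'
    measure_ball_lt_top.ne
  have hvol : ∀ (x : Rn n) (r : ℝ), 0 < r →
      volume (Metric.ball x r) = ENNReal.ofReal (b * r ^ (n : ℝ)) := by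
    intro x r hr
    have : Nontrivial (Rn n) := Module.nontrivial_of_finrank_pos (R := ℝ) (by
      rw [finrank_euclideanSpace_fin]; exact_mod_cast hn0)
    rw [Measure.addHaar_ball _ x hr.le, mul_comm, ENNReal.ofReal_mul hb0.le, hb,
      ENNReal.ofReal_toReal measure_ball_lt_top.ne]
    simp
  set c₁ := b ^ (-(1 / p)) with hc₁
  set c₂ := b ^ (-(1 / q)) with hc₂
  have hc₁0 : 0 < c₁ := by positivity
  have hc₂0 : 0 < c₂ := by positivity
  set K := (2 * c₁) ^ p * (2 * c₂) ^ (q - p) with hK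
  have hK0 : 0 < K := by positivity
  refine ⟨ENNReal.ofReal K ^ (1 / p), by finiteness, fun u hu hmem => ?_⟩
  set A := eLpNorm u (critExp n s p) volume with hA
  have hAtop : A ≠ ∞ := hmem.eLpNorm_lt_top.ne
  rcases eq_or_ne A 0 with hA0 | hA0
  · rw [hA0]; exact zero_le
  set a := A.toReal with ha
  have ha0 : 0 < a := ENNReal.toReal_pos hA0 hAtop
  have hAa : A = ENNReal.ofReal a := (ENNReal.ofReal_toReal hAtop).symm
  set D : Rn n → ℝ≥0∞ := fun x => eLpNorm (fun y => quot n s p u (x, y)) (ENNReal.ofReal p) volume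
    with hD
  have hpt : ∀ x, ‖u x‖ₑ ^ q ≤ ENNReal.ofReal (K * a ^ (q - p)) * D x ^ p := by
    intro x
    rcases eq_or_ne (D x) ∞ with hDx | hDx
    · rw [hDx, ENNReal.top_rpow_of_pos hp0, ENNReal.mul_top]
      · exact le_top
      · simp only [ne_eq, ENNReal.ofReal_eq_zero, not_le]; positivity
    have hDd : D x = ENNReal.ofReal (D x).toReal := (ENNReal.ofReal_toReal hDx).symm
    have hd0 : 0 ≤ (D x).toReal := ENNReal.toReal_nonneg
    have key : ∀ r > 0, |u x| ≤ c₁ * (D x).toReal * r ^ s + c₂ * a * r ^ (-((n : ℝ) / q)) := by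
      intro r hr
      have h := mul_volume_ball_le (n := n) (s := s) (p := p) (q := critExp n s p) hs0 hp
        (by rw [hcrit]; simpa using hp.trans hpq) hu x hr
      rw [← hA, hvol x r hr, hAa, hcrit, ENNReal.toReal_ofReal hq0.le] at h
      change _ ≤ _ * (D x * _) + _ at h
      rw [hDd, ← ofReal_norm, Real.norm_eq_abs] at h
      have hv : 0 < b * r ^ (n : ℝ) := by positivity
      rw [ENNReal.ofReal_rpow_of_pos hv, ENNReal.ofReal_rpow_of_pos hv,
        ← ENNReal.ofReal_mul (by positivity), ← ENNReal.ofReal_mul (by positivity),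
        ← ENNReal.ofReal_mul (by positivity), ← ENNReal.ofReal_mul (by positivity),
        ← ENNReal.ofReal_add (by positivity) (by positivity),
        ENNReal.ofReal_le_ofReal_iff (by positivity)] at h
      rw [← le_div_iff₀ hv] at h
      refine h.trans_eq ?_
      rw [add_div, sub_eq_add_neg, sub_eq_add_neg, Real.rpow_add hv, Real.rpow_add hv,
        Real.rpow_one, Real.mul_rpow hb0.le (by positivity),
        Real.mul_rpow hb0.le (by positivity), ← Real.rpow_mul hr.le, ← Real.rpow_mul hr.le,
        Real.rpow_add hr, ← hc₁, ← hc₂]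
      have e1 : r ^ ((n : ℝ) / p) * r ^ ((n : ℝ) * -(1 / p)) = 1 := by
        rw [← Real.rpow_add hr]
        have : (n : ℝ) / p + n * -(1 / p) = 0 := by ring
        rw [this, Real.rpow_zero]
      have e2 : (n : ℝ) * -(1 / q) = -((n : ℝ) / q) := by ring
      rw [e2]
      generalize r ^ ((n : ℝ) / p) = y1 at *
      generalize r ^ ((n : ℝ) * -(1 / p)) = y2 at *
      field_simp
      linear_combination r ^ s * (D x).toReal * c₁ * e1
    have hθ : q = p + s / ((n : ℝ) / q) * p := by
      rw [hq]
      obtain ⟨X, hX⟩ : ∃ X, X = (n : ℝ) - s * p := ⟨_, rfl⟩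
      have hnX : (n : ℝ) = X + s * p := by rw [hX]; ring
      rw [← hX] at hns ⊢
      field_simp
      linarith
    have := rpow_le_of_forall_radius hc₁0 hc₂0 (by positivity) hp0 hθ ha0 (abs_nonneg _) hd0 hq0 key
    rw [hDd, ← ofReal_norm, Real.norm_eq_abs, ENNReal.ofReal_rpow_of_nonneg (abs_nonneg _) hq0.le,
      ENNReal.ofReal_rpow_of_nonneg hd0 hp0.le, ← ENNReal.ofReal_mul (by positivity)]
    exact ENNReal.ofReal_le_ofReal this
  have hQm : StronglyMeasurable (quot n s p u) := by
    have h3 : Measurable fun z : Rn n × Rn n => (‖z.1 - z.2‖ ^ ((n : ℝ) / p + s))⁻¹ := by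
      fun_prop
    exact h3.stronglyMeasurable.mul
      ((hu.comp_measurable measurable_fst).sub (hu.comp_measurable measurable_snd))
  have hpp : ENNReal.ofReal p ≠ 0 := by simpa using hp0
  have hqq : ENNReal.ofReal q ≠ 0 := by simpa using hq0
  have hDp : ∫⁻ x, D x ^ p = eLpNorm (quot n s p u) (ENNReal.ofReal p) volume ^ p := by
    simp only [hD, eLpNorm_eq_lintegral_rpow_enorm_toReal hpp ENNReal.ofReal_ne_top,
      ENNReal.toReal_ofReal hp0.le, one_div, ENNReal.rpow_inv_rpow hp0.ne']
    rw [Measure.volume_eq_prod, lintegral_prod _ (hQm.enorm.pow_const _).aemeasurable]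
  have hAq : A ^ q = ∫⁻ x, ‖u x‖ₑ ^ q := by
    rw [hA, hcrit, eLpNorm_eq_lintegral_rpow_enorm_toReal hqq ENNReal.ofReal_ne_top,
      ENNReal.toReal_ofReal hq0.le, one_div, ENNReal.rpow_inv_rpow hq0.ne']
  have hint : A ^ q ≤ ENNReal.ofReal (K * a ^ (q - p)) *
      eLpNorm (quot n s p u) (ENNReal.ofReal p) volume ^ p := by
    rw [hAq, ← hDp, ← lintegral_const_mul' _ _ ENNReal.ofReal_ne_top]
    exact lintegral_mono hpt
  have hAp : A ^ p ≤ ENNReal.ofReal K * eLpNorm (quot n s p u) (ENNReal.ofReal p) volume ^ p := by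
    have e : A ^ q = A ^ (q - p) * A ^ p := by
      rw [← ENNReal.rpow_add _ _ hA0 hAtop]; congr 1; ring
    rw [e, ENNReal.ofReal_mul hK0.le, ← ENNReal.ofReal_rpow_of_pos ha0, ← hAa,
      mul_comm (ENNReal.ofReal K), mul_assoc] at hint
    refine (ENNReal.mul_le_mul_iff_right ?_ ?_).1 hint
    · exact (ENNReal.rpow_pos (pos_iff_ne_zero.2 hA0) hAtop).ne'
    · exact ENNReal.rpow_ne_top_of_nonneg (by linarith) hAtop
  rw [← ENNReal.rpow_le_rpow_iff hp0, ENNReal.mul_rpow_of_nonneg _ _ hp0.le, one_div,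
    ENNReal.rpow_inv_rpow hp0.ne']
  exact hAp

/-! ### Density of test functions for the fractional seminorm -/

theorem tendsto_eLpNorm_zero_of_dominated {α E G : Type*} [MeasurableSpace α] {μ : Measure α}
    [NormedAddCommGroup E] [NormedAddCommGroup G] {p : ℝ≥0∞} (hp0 : p ≠ 0) (hp : p ≠ ∞)
    {f : ℕ → α → E} {F : α → G} (hf : ∀ k, AEStronglyMeasurable (f k) μ) (hF : MemLp F p μ)
    (hle : ∀ k x, ‖f k x‖ ≤ ‖F x‖) (hlim : ∀ x, Tendsto (fun k => f k x) atTop (𝓝 0)) :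
    Tendsto (fun k => eLpNorm (f k) p μ) atTop (𝓝 0) := by
  have hpr : 0 < p.toReal := ENNReal.toReal_pos hp0 hp
  have h : Tendsto (fun k => ∫⁻ x, ‖f k x‖ₑ ^ p.toReal ∂μ) atTop (𝓝 (∫⁻ _, 0 ∂μ)) := by
    refine tendsto_lintegral_of_dominated_convergence' (fun x => ‖F x‖ₑ ^ p.toReal)
      (fun k => (hf k).enorm.pow_const _) (fun k => Eventually.of_forall fun x => ?_) ?_
      (Eventually.of_forall fun x => ?_)
    · exact ENNReal.rpow_le_rpow (enorm_le_iff_norm_le.2 (hle k x)) hpr.le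
    · exact (lintegral_rpow_enorm_lt_top_of_eLpNorm_lt_top hp0 hp hF.eLpNorm_lt_top).ne
    · have h1 := (continuous_enorm.tendsto _).comp (hlim x)
      rw [enorm_zero] at h1
      have h2 := (ENNReal.continuous_rpow_const (y := p.toReal)).tendsto 0 |>.comp h1
      rwa [ENNReal.zero_rpow_of_pos hpr] at h2
  rw [lintegral_zero] at h
  have h2 := (ENNReal.continuous_rpow_const (y := 1 / p.toReal)).tendsto 0 |>.comp h
  rw [ENNReal.zero_rpow_of_pos (by positivity)] at h2
  refine h2.congr fun k => ?_
  rw [eLpNorm_eq_lintegral_rpow_enorm_toReal hp0 hp]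
  rfl

theorem exists_test_eq_mollify {n : ℕ} (b : ContDiffBump (0 : Rn n)) {v : Rn n → ℝ}
    (hv : LocallyIntegrable v) (hc : HasCompactSupport v) :
    ∃ ψ : Cc n, ∀ x, ψ x = ∫ h, b.normed volume h • v (x - h) := by
  refine ⟨⟨convolution (b.normed volume) v (ContinuousLinearMap.lsmul ℝ ℝ) volume, ?_, ?_,
    by simp⟩, fun x => rfl⟩
  · exact b.hasCompactSupport_normed.contDiff_convolution_left _ b.contDiff_normed hv
  · exact b.hasCompactSupport_normed.convolution _ hc

theorem measurable_quot_kernel {n : ℕ} (a : ℝ) :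
    Measurable fun z : Rn n × Rn n => (‖z.1 - z.2‖ ^ a)⁻¹ := by
  fun_prop

theorem stronglyMeasurable_quot {n : ℕ} {s p : ℝ} {u : Rn n → ℝ} (hu : StronglyMeasurable u) :
    StronglyMeasurable (quot n s p u) :=
  (measurable_quot_kernel _).stronglyMeasurable.mul
    ((hu.comp_measurable measurable_fst).sub (hu.comp_measurable measurable_snd))

theorem quot_sub {n : ℕ} {s p : ℝ} (u v : Rn n → ℝ) :
    quot n s p (u - v) = quot n s p u - quot n s p v := by
  funext z; simp only [quot, Pi.sub_apply]; ring

theorem norm_quot_le_of_abs_sub_le {n : ℕ} {s p : ℝ} {u v : Rn n → ℝ} {z : Rn n × Rn n}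
    (h : |u z.1 - u z.2| ≤ |v z.1 - v z.2|) : ‖quot n s p u z‖ ≤ ‖quot n s p v z‖ := by
  simp only [quot, norm_mul, Real.norm_eq_abs]
  gcongr

theorem abs_clamp_sub_clamp_le {ε : ℝ} (a b : ℝ) :
    |max (-ε) (min a ε) - max (-ε) (min b ε)| ≤ |a - b| := by
  refine (abs_max_sub_max_le_max _ _ _ _).trans ?_
  rw [sub_self, abs_zero, max_eq_right (abs_nonneg _)]
  refine (abs_min_sub_min_le_max _ _ _ _).trans ?_
  rw [sub_self, abs_zero, max_eq_left (abs_nonneg _)]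

theorem abs_clamp_le {ε : ℝ} (hε : 0 ≤ ε) (a : ℝ) : |max (-ε) (min a ε)| ≤ ε :=
  abs_le.2 ⟨le_max_left _ _, max_le (by linarith) (min_le_right _ _)⟩

/-- Removing the values below the level `ε` turns a function of `L^q` into one of `L^p` for `p ≤ q`:
the result vanishes where `|u| ≤ ε`, and `|u| ^ p ≤ ε ^ (p - q) |u| ^ q` elsewhere. -/
theorem memLp_sub_clamp {n : ℕ} {p q ε : ℝ} (hp : 0 < p) (hpq : p ≤ q) (hε : 0 < ε)
    {u : Rn n → ℝ} (hu : MemLp u (ENNReal.ofReal q) volume) :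
    MemLp (fun x => u x - max (-ε) (min (u x) ε)) (ENNReal.ofReal p) volume := by
  have hq : 0 < q := hp.trans_le hpq
  have hp' : ENNReal.ofReal p ≠ 0 := by simpa using hp
  have hq' : ENNReal.ofReal q ≠ 0 := by simpa using hq
  have hc : Continuous fun a : ℝ => a - max (-ε) (min a ε) := by fun_prop
  refine ⟨hc.comp_aestronglyMeasurable hu.1, ?_⟩
  have hu2 := lintegral_rpow_enorm_lt_top_of_eLpNorm_lt_top hq' ENNReal.ofReal_ne_top
    hu.eLpNorm_lt_top
  rw [eLpNorm_lt_top_iff_lintegral_rpow_enorm_lt_top hp' ENNReal.ofReal_ne_top,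
    ENNReal.toReal_ofReal hp.le]
  rw [ENNReal.toReal_ofReal hq.le] at hu2
  have hpt : ∀ x, ‖u x - max (-ε) (min (u x) ε)‖ₑ ^ p ≤
      ENNReal.ofReal (ε ^ (p - q)) * ‖u x‖ₑ ^ q := by
    intro x
    rw [← ofReal_norm, ← ofReal_norm, ENNReal.ofReal_rpow_of_nonneg (norm_nonneg _) hp.le,
      ENNReal.ofReal_rpow_of_nonneg (norm_nonneg _) hq.le, ← ENNReal.ofReal_mul (by positivity)]
    refine ENNReal.ofReal_le_ofReal ?_
    rw [Real.norm_eq_abs, Real.norm_eq_abs]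
    rcases le_or_gt |u x| ε with h | h
    · have : u x - max (-ε) (min (u x) ε) = 0 := by
        rw [min_eq_left (le_of_abs_le h), max_eq_right (neg_le_of_abs_le h), sub_self]
      rw [this, abs_zero, Real.zero_rpow hp.ne']
      positivity
    · have h1 : |u x - max (-ε) (min (u x) ε)| ≤ |u x| := by
        rcases le_total 0 (u x) with h0 | h0
        · rw [abs_of_nonneg h0] at h ⊢
          rw [min_eq_right h.le, max_eq_right (by linarith), abs_of_nonneg (by linarith)]
          linarith
        · rw [abs_of_nonpos h0] at h ⊢
          rw [min_eq_left (by linarith), max_eq_left (by linarith), abs_of_nonpos (by linarith)]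
          linarith
      have h0 : 0 < |u x| := hε.trans h
      calc |u x - max (-ε) (min (u x) ε)| ^ p ≤ |u x| ^ p := by gcongr
        _ = |u x| ^ (p - q) * |u x| ^ q := by rw [← Real.rpow_add h0]; congr 1; ring
        _ ≤ ε ^ (p - q) * |u x| ^ q := by
          have := Real.rpow_le_rpow_of_nonpos hε h.le (sub_nonpos.2 hpq)
          gcongr
  refine (lintegral_mono hpt).trans_lt ?_
  rw [lintegral_const_mul' _ _ ENNReal.ofReal_ne_top]
  exact ENNReal.mul_lt_top ENNReal.ofReal_lt_top hu2

/-- In the fractional seminorm `u` is approximated by functions of `L^p`: subtract the clamping of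
`u` to `[-ε, ε]`, which is a contraction of the values of `u` that tends to `0` with `ε`. -/
theorem exists_memLp_quot_sub_le {n : ℕ} {s p q : ℝ} (hp : 1 ≤ p) (hpq : p ≤ q)
    {u : Rn n → ℝ} (hu : StronglyMeasurable u) (huq : MemLp u (ENNReal.ofReal q) volume)
    (hQ : MemLp (quot n s p u) (ENNReal.ofReal p) volume) {δ : ℝ≥0∞} (hδ : δ ≠ 0) :
    ∃ w : Rn n → ℝ, StronglyMeasurable w ∧ MemLp w (ENNReal.ofReal p) volume ∧
      eLpNorm (quot n s p (u - w)) (ENNReal.ofReal p) volume ≤ δ := by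
  have hp0 : 0 < p := by linarith
  set T : ℕ → Rn n → ℝ := fun k x => max (-(1 / ((k : ℝ) + 1))) (min (u x) (1 / ((k : ℝ) + 1)))
    with hT
  have hTm : ∀ k, StronglyMeasurable (T k) := fun k =>
    stronglyMeasurable_const.sup (hu.inf stronglyMeasurable_const)
  have hlim : Tendsto (fun k => eLpNorm (quot n s p (T k)) (ENNReal.ofReal p) volume) atTop
      (𝓝 0) := by
    refine tendsto_eLpNorm_zero_of_dominated (by simpa using hp0) ENNReal.ofReal_ne_top
      (fun k => (stronglyMeasurable_quot (hTm k)).aestronglyMeasurable) hQ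
      (fun k z => norm_quot_le_of_abs_sub_le (abs_clamp_sub_clamp_le _ _)) fun z => ?_
    have hT0 : ∀ x, Tendsto (fun k => T k x) atTop (𝓝 0) := fun x =>
      squeeze_zero_norm (fun k => abs_clamp_le (by positivity) _)
        tendsto_one_div_add_atTop_nhds_zero_nat
    have := ((hT0 z.1).sub (hT0 z.2)).const_mul (‖z.1 - z.2‖ ^ ((n : ℝ) / p + s))⁻¹
    simpa [quot] using this
  obtain ⟨k, hk⟩ := (hlim.eventually_le_const (pos_iff_ne_zero.2 hδ)).exists
  refine ⟨u - T k, hu.sub (hTm k), memLp_sub_clamp hp0 hpq (by positivity) huq, ?_⟩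
  rwa [sub_sub_cancel]

/-- The cutoff equal to `1` on the ball of radius `R`, to `0` outside the ball of radius `2 R`, and
affine in `‖x‖` in between. It is `1 / R`-Lipschitz; smoothness is not needed, since a
mollification follows. -/
noncomputable def tent {n : ℕ} (R : ℝ) (x : Rn n) : ℝ := max 0 (min 1 (2 - ‖x‖ / R))

theorem tent_nonneg {n : ℕ} (R : ℝ) (x : Rn n) : 0 ≤ tent R x := le_max_left _ _

theorem tent_le_one {n : ℕ} (R : ℝ) (x : Rn n) : tent R x ≤ 1 :=
  max_le zero_le_one (min_le_left _ _)

theorem continuous_tent {n : ℕ} (R : ℝ) : Continuous (tent R : Rn n → ℝ) := by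
  unfold tent; fun_prop

theorem tent_eq_one {n : ℕ} {R : ℝ} (hR : 0 < R) {x : Rn n} (h : ‖x‖ ≤ R) : tent R x = 1 := by
  have : ‖x‖ / R ≤ 1 := by rwa [div_le_one hR]
  rw [tent, min_eq_left (by linarith), max_eq_right zero_le_one]

theorem hasCompactSupport_tent {n : ℕ} {R : ℝ} (hR : 0 < R) :
    HasCompactSupport (tent R : Rn n → ℝ) := by
  refine HasCompactSupport.intro (isCompact_closedBall (0 : Rn n) (2 * R)) fun x hx => ?_
  rw [mem_closedBall_zero_iff, not_le] at hx
  have : 2 ≤ ‖x‖ / R := by rw [le_div_iff₀ hR]; exact hx.le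
  rw [tent, max_eq_left ((min_le_right _ _).trans (by linarith))]

theorem abs_tent_sub_le {n : ℕ} {R : ℝ} (hR : 0 < R) (x y : Rn n) :
    |tent R x - tent R y| ≤ min (‖x - y‖ / R) 1 := by
  refine le_min ?_ ?_
  · refine (abs_max_sub_max_le_max _ _ _ _).trans ?_
    rw [sub_self, abs_zero, max_eq_right (abs_nonneg _)]
    refine (abs_min_sub_min_le_max _ _ _ _).trans ?_
    rw [sub_self, abs_zero, max_eq_right (abs_nonneg _)]
    have : 2 - ‖x‖ / R - (2 - ‖y‖ / R) = (‖y‖ - ‖x‖) / R := by ring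
    rw [this, abs_div, abs_of_pos hR, norm_sub_rev x y]
    gcongr
    exact abs_norm_sub_norm_le y x
  · exact abs_sub_le_of_nonneg_of_le (tent_nonneg _ _) (tent_le_one _ _) (tent_nonneg _ _)
      (tent_le_one _ _)

/-- The integral over `x` of `|η x - η y| ^ p / |x - y| ^ (n + s p)` for the cutoff `η = tent R` is
bounded uniformly in `y`, and the bound tends to `0` as `R → ∞`. This is the bound. -/
theorem tendsto_lintegral_majorant {n : ℕ} (hn : 1 ≤ n) {s p : ℝ} (hs0 : 0 < s) (hs1 : s < 1)
    (hp : 1 ≤ p) :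
    Tendsto (fun k : ℕ => ∫⁻ h : Rn n, ENNReal.ofReal
      (min (‖h‖ / ((k : ℝ) + 1)) 1 ^ p / ‖h‖ ^ ((n : ℝ) + s * p))) atTop (𝓝 0) := by
  have hp0 : 0 < p := by linarith
  rw [← lintegral_zero (α := Rn n) (μ := volume)]
  refine tendsto_lintegral_of_dominated_convergence
    (fun h => ENNReal.ofReal (min (1 * ‖h‖) 1 ^ p / ‖h‖ ^ ((n : ℝ) + s * p)))
    (fun k => by fun_prop) (fun k => Eventually.of_forall fun h => ?_)
    (lintegral_majorant hn hs0 hs1 hp zero_le_one zero_le_one).ne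
    (Eventually.of_forall fun h => ?_)
  · refine ENNReal.ofReal_le_ofReal ?_
    gcongr
    rw [one_mul]
    exact div_le_self (norm_nonneg _) (by linarith [Nat.cast_nonneg (α := ℝ) k])
  · have h1 : Tendsto (fun k : ℕ => ‖h‖ / ((k : ℝ) + 1)) atTop (𝓝 0) := by
      simpa [div_eq_mul_inv] using
        (tendsto_one_div_add_atTop_nhds_zero_nat (𝕜 := ℝ)).const_mul ‖h‖
    have h2 := ((h1.min (tendsto_const_nhds (x := (1 : ℝ)))).rpow_const (p := p)
      (Or.inr hp0.le)).div_const (‖h‖ ^ ((n : ℝ) + s * p))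
    have h3 := ENNReal.tendsto_ofReal h2
    rw [min_eq_left zero_le_one, Real.zero_rpow hp0.ne', zero_div, ENNReal.ofReal_zero] at h3
    exact h3

theorem enorm_quot_rpow {n : ℕ} {s p : ℝ} (hp : 0 < p) (u : Rn n → ℝ) (z : Rn n × Rn n) :
    ‖quot n s p u z‖ₑ ^ p =
      ENNReal.ofReal (|u z.1 - u z.2| ^ p / ‖z.1 - z.2‖ ^ ((n : ℝ) + s * p)) := by
  rw [Real.enorm_eq_ofReal_abs, ENNReal.ofReal_rpow_of_nonneg (abs_nonneg _) hp.le]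
  congr 1
  have h0 : (0 : ℝ) ≤ ‖z.1 - z.2‖ := norm_nonneg _
  rw [quot, abs_mul, abs_inv, abs_of_nonneg (Real.rpow_nonneg h0 _),
    Real.mul_rpow (by positivity) (abs_nonneg _), Real.inv_rpow (by positivity),
    ← Real.rpow_mul h0]
  have : ((n : ℝ) / p + s) * p = n + s * p := by field_simp
  rw [this]
  ring

/-- In the fractional seminorm a function `w` of `L^p` is approximated by its truncations `η w`. The
difference quotient of `w - η w` splits into `(1 - η x) * quot w`, which tends to `0` by dominated
convergence, and `w y * quot η`, whose norm is at most `‖w‖_p` times the quantity of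
`tendsto_lintegral_majorant`. -/
theorem exists_hasCompactSupport_quot_sub_le {n : ℕ} (hn : 1 ≤ n) {s p : ℝ} (hs0 : 0 < s)
    (hs1 : s < 1) (hp : 1 ≤ p) {w : Rn n → ℝ} (hw : StronglyMeasurable w)
    (hwp : MemLp w (ENNReal.ofReal p) volume)
    (hQ : MemLp (quot n s p w) (ENNReal.ofReal p) volume) {δ : ℝ≥0∞} (hδ : δ ≠ 0) :
    ∃ v : Rn n → ℝ, StronglyMeasurable v ∧ MemLp v (ENNReal.ofReal p) volume ∧
      HasCompactSupport v ∧ eLpNorm (quot n s p (w - v)) (ENNReal.ofReal p) volume ≤ δ := by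
  have hp0 : 0 < p := by linarith
  have hp' : ENNReal.ofReal p ≠ 0 := by simpa using hp0
  have hp1 : 1 ≤ ENNReal.ofReal p := by simpa using hp
  set η : ℕ → Rn n → ℝ := fun k => tent ((k : ℝ) + 1) with hη
  have hk0 : ∀ k : ℕ, (0 : ℝ) < (k : ℝ) + 1 := fun k => by positivity
  have hηm : ∀ k, StronglyMeasurable (η k) := fun k => (continuous_tent _).stronglyMeasurable
  set f : ℕ → Rn n × Rn n → ℝ := fun k z => (1 - η k z.1) * quot n s p w z with hf
  set g : ℕ → Rn n × Rn n → ℝ := fun k z => w z.2 * quot n s p (η k) z with hg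
  have hfm : ∀ k, StronglyMeasurable (f k) := fun k =>
    (stronglyMeasurable_const.sub ((hηm k).comp_measurable measurable_fst)).mul
      (stronglyMeasurable_quot hw)
  have hgm : ∀ k, StronglyMeasurable (g k) := fun k =>
    (hw.comp_measurable measurable_snd).mul (stronglyMeasurable_quot (hηm k))
  have hsplit : ∀ k, quot n s p (w - η k * w) = f k - g k := by
    intro k; funext z
    simp only [quot, hf, hg, Pi.sub_apply, Pi.mul_apply]; ring
  have hflim : Tendsto (fun k => eLpNorm (f k) (ENNReal.ofReal p) volume) atTop (𝓝 0) := by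
    refine tendsto_eLpNorm_zero_of_dominated hp' ENNReal.ofReal_ne_top
      (fun k => (hfm k).aestronglyMeasurable) hQ (fun k z => ?_) fun z => ?_
    · rw [norm_mul]
      refine mul_le_of_le_one_left (norm_nonneg _) ?_
      rw [Real.norm_eq_abs, abs_le]
      constructor <;> linarith [tent_nonneg ((k : ℝ) + 1) z.1, tent_le_one ((k : ℝ) + 1) z.1]
    · refine tendsto_const_nhds.congr' ?_
      filter_upwards [eventually_ge_atTop ⌈‖z.1‖⌉₊] with k hk
      have : ‖z.1‖ ≤ (k : ℝ) + 1 := by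
        have := Nat.le_ceil ‖z.1‖
        have h2 : (⌈‖z.1‖⌉₊ : ℝ) ≤ k := by exact_mod_cast hk
        linarith
      simp [hf, hη, tent_eq_one (hk0 k) this]
  have hgle : ∀ k, eLpNorm (g k) (ENNReal.ofReal p) volume ≤
      eLpNorm w (ENNReal.ofReal p) volume * (∫⁻ h : Rn n, ENNReal.ofReal
      (min (‖h‖ / ((k : ℝ) + 1)) 1 ^ p / ‖h‖ ^ ((n : ℝ) + s * p))) ^ (1 / p) := by
    intro k
    set m : Rn n → ℝ≥0∞ := fun h => ENNReal.ofReal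
      (min (‖h‖ / ((k : ℝ) + 1)) 1 ^ p / ‖h‖ ^ ((n : ℝ) + s * p)) with hm
    have hmm : Measurable m := by fun_prop
    rw [eLpNorm_eq_lintegral_rpow_enorm_toReal hp' ENNReal.ofReal_ne_top,
      eLpNorm_eq_lintegral_rpow_enorm_toReal hp' ENNReal.ofReal_ne_top,
      ENNReal.toReal_ofReal hp0.le, ← ENNReal.mul_rpow_of_nonneg _ _ (by positivity)]
    gcongr
    calc ∫⁻ z, ‖g k z‖ₑ ^ p ≤ ∫⁻ z : Rn n × Rn n, ‖w z.2‖ₑ ^ p * m (z.1 - z.2) := by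
          refine lintegral_mono fun z => ?_
          simp only [hg]
          rw [enorm_mul, ENNReal.mul_rpow_of_nonneg _ _ hp0.le, enorm_quot_rpow hp0]
          gcongr
          refine ENNReal.ofReal_le_ofReal ?_
          gcongr
          exact abs_tent_sub_le (hk0 k) _ _
      _ = ∫⁻ y, ∫⁻ x, ‖w y‖ₑ ^ p * m (x - y) := by
          rw [Measure.volume_eq_prod, lintegral_prod_symm]
          exact ((hw.enorm.pow_const p).comp measurable_snd |>.mul
            (hmm.comp (measurable_fst.sub measurable_snd))).aemeasurable
      _ = ∫⁻ y, ‖w y‖ₑ ^ p * ∫⁻ h, m h := by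
          refine lintegral_congr fun y => ?_
          rw [lintegral_const_mul _ (by fun_prop), lintegral_sub_right_eq_self m y]
      _ = _ := lintegral_mul_const _ (hw.enorm.pow_const p)
  have hglim : Tendsto (fun k => eLpNorm (g k) (ENNReal.ofReal p) volume) atTop (𝓝 0) := by
    have h1 := (ENNReal.continuous_rpow_const (y := 1 / p)).tendsto 0 |>.comp
      (tendsto_lintegral_majorant hn hs0 hs1 hp)
    rw [ENNReal.zero_rpow_of_pos (by positivity)] at h1
    have h2 := ENNReal.Tendsto.const_mul (a := eLpNorm w (ENNReal.ofReal p) volume) h1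
      (Or.inr hwp.eLpNorm_lt_top.ne)
    rw [mul_zero] at h2
    exact tendsto_of_tendsto_of_tendsto_of_le_of_le tendsto_const_nhds h2 (fun _ => zero_le) hgle
  have hlim := hflim.add hglim
  rw [add_zero] at hlim
  obtain ⟨k, hk⟩ := (hlim.eventually_le_const (pos_iff_ne_zero.2 hδ)).exists
  refine ⟨η k * w, (hηm k).mul hw, ?_, (hasCompactSupport_tent (hk0 k)).mul_right, ?_⟩
  · refine hwp.of_le ((hηm k).mul hw).aestronglyMeasurable (Eventually.of_forall fun x => ?_)
    rw [Pi.mul_apply, norm_mul]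
    refine mul_le_of_le_one_left (norm_nonneg _) ?_
    rw [Real.norm_eq_abs, abs_of_nonneg (tent_nonneg _ _)]
    exact tent_le_one _ _
  · rw [hsplit k]
    exact (eLpNorm_sub_le (hfm k).aestronglyMeasurable (hgm k).aestronglyMeasurable hp1).trans hk

theorem quot_mollify {n : ℕ} {s p : ℝ} (b : ContDiffBump (0 : Rn n)) {v : Rn n → ℝ}
    (hv : LocallyIntegrable v) (z : Rn n × Rn n) :
    quot n s p (fun x => ∫ h, b.normed volume h • v (x - h)) z =
      ∫ h, b.normed volume h • quot n s p v (z - (h, h)) := by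
  have hint : ∀ x, Integrable fun h => b.normed volume h • v (x - h) := fun x =>
    (b.hasCompactSupport_normed.convolutionExists_left (ContinuousLinearMap.lsmul ℝ ℝ)
      b.continuous_normed hv x)
  rw [quot, ← integral_sub (hint _) (hint _), ← integral_const_mul]
  refine integral_congr_ae (Eventually.of_forall fun h => ?_)
  simp only [quot, Prod.fst_sub, Prod.snd_sub, sub_sub_sub_cancel_right, smul_eq_mul]
  ring

theorem exists_test_quot_sub_le_of_hasCompactSupport {n : ℕ} {s p : ℝ} (hp : 1 ≤ p)
    {v : Rn n → ℝ} (hv : StronglyMeasurable v)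
    (hvp : MemLp v (ENNReal.ofReal p) volume) (hc : HasCompactSupport v)
    (hQ : MemLp (quot n s p v) (ENNReal.ofReal p) volume) {δ : ℝ≥0∞} (hδ : δ ≠ 0) :
    ∃ φ : Cc n, eLpNorm (quot n s p (v - φ)) (ENNReal.ofReal p) volume ≤ δ := by
  have hp1 : 1 ≤ ENNReal.ofReal p := by simpa using hp
  have hloc : LocallyIntegrable v := hvp.locallyIntegrable hp1
  obtain ⟨r, hr, h⟩ := exists_eLpNorm_mollify_sub_le 
    (μ := (volume : Measure (Rn n)).prod (volume : Measure (Rn n))) hp1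
    ENNReal.ofReal_ne_top (ι := fun h : Rn n => (h, h)) (by fun_prop) rfl
    (stronglyMeasurable_quot hv) hQ hδ
  let b : ContDiffBump (0 : Rn n) := ⟨r / 4, r / 2, by positivity, by linarith⟩
  obtain ⟨ψ, hψ⟩ := exists_test_eq_mollify b hloc hc
  refine ⟨ψ, ?_⟩
  have hb := h b (by change r / 2 < r; linarith)
  refine le_of_eq_of_le ?_ hb
  have e : (ψ : Rn n → ℝ) = fun x => ∫ h, b.normed volume h • v (x - h) := funext hψ
  rw [quot_sub, eLpNorm_sub_comm, e]
  congr 1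
  funext z
  rw [Pi.sub_apply, quot_mollify b hloc]

theorem exists_test_quot_sub_le {n : ℕ} {s p : ℝ} (hs0 : 0 < s) (hs1 : s < 1) (hp : 1 ≤ p)
    (hsp : s * p < n) {u : Rn n → ℝ} (hu : StronglyMeasurable u)
    (huq : MemLp u (critExp n s p) volume)
    (hQ : MemLp (quot n s p u) (ENNReal.ofReal p) volume) {δ : ℝ≥0∞} (hδ : δ ≠ 0) :
    ∃ φ : Cc n, eLpNorm (quot n s p (u - φ)) (ENNReal.ofReal p) volume ≤ δ := by
  have hp0 : 0 < p := by linarith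
  have hp1 : 1 ≤ ENNReal.ofReal p := by simpa using hp
  have hn0 : 0 < (n : ℝ) := by nlinarith [mul_pos hs0 hp0]
  have hpq : p ≤ (n : ℝ) * p / ((n : ℝ) - s * p) := by
    rw [le_div_iff₀ (by linarith)]; nlinarith [mul_pos hs0 hp0]
  have hδ3 : δ / 3 ≠ 0 := by simpa using hδ
  -- closeness in seminorm keeps the difference quotient in `L^p`
  have hstep : ∀ {f g : Rn n → ℝ}, MemLp (quot n s p f) (ENNReal.ofReal p) volume →
      StronglyMeasurable g → (∃ ε : ℝ≥0∞, ε ≠ ∞ ∧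
        eLpNorm (quot n s p (f - g)) (ENNReal.ofReal p) volume ≤ ε) →
      MemLp (quot n s p g) (ENNReal.ofReal p) volume := by
    rintro f g hf hg ⟨ε, hε, hle⟩
    have e : quot n s p g = quot n s p f - quot n s p (f - g) := by rw [quot_sub]; abel
    rw [quot_sub] at hle
    have hm := hf.1.sub (stronglyMeasurable_quot (s := s) (p := p) hg).aestronglyMeasurable
    rw [e, quot_sub]
    exact hf.sub ⟨hm, hle.trans_lt hε.lt_top⟩
  wlog hδt : δ ≠ ∞ generalizing δ
  · rw [not_not] at hδt
    obtain ⟨φ, -⟩ := this (δ := 1) one_ne_zero (by simp) ENNReal.one_ne_top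
    exact ⟨φ, hδt ▸ le_top⟩
  have hδ3t : δ / 3 ≠ ∞ := ENNReal.div_ne_top hδt (by simp)
  obtain ⟨w, hw, hwp, hw1⟩ := exists_memLp_quot_sub_le hp hpq hu huq hQ hδ3
  have hwQ := hstep hQ hw ⟨_, hδ3t, hw1⟩
  obtain ⟨v, hv, hvp, hvc, hv1⟩ := exists_hasCompactSupport_quot_sub_le
    (by exact_mod_cast hn0) hs0 hs1 hp hw hwp hwQ hδ3
  have hvQ := hstep hwQ hv ⟨_, hδ3t, hv1⟩
  obtain ⟨φ, hφ⟩ := exists_test_quot_sub_le_of_hasCompactSupport hp hv hvp hvc hvQ hδ3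
  refine ⟨φ, ?_⟩
  have hφm : StronglyMeasurable φ := φ.continuous.stronglyMeasurable
  have e : quot n s p (u - φ) = quot n s p (u - w) + (quot n s p (w - v) + quot n s p (v - φ)) := by
    simp only [quot_sub]; abel
  have m1 := (stronglyMeasurable_quot (s := s) (p := p) (hu.sub hw)).aestronglyMeasurable
    (μ := volume)
  have m2 := (stronglyMeasurable_quot (s := s) (p := p) (hw.sub hv)).aestronglyMeasurable
    (μ := volume)
  have m3 := (stronglyMeasurable_quot (s := s) (p := p) (hv.sub hφm)).aestronglyMeasurable
    (μ := volume)
  rw [e]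
  calc _ ≤ _ := eLpNorm_add_le m1 (m2.add m3) hp1
    _ ≤ δ / 3 + (δ / 3 + δ / 3) := by
      gcongr
      exact (eLpNorm_add_le m2 m3 hp1).trans (by gcongr)
    _ = δ := by rw [← add_assoc, ENNReal.add_thirds]

/-! ### Calculus of weak gradients -/

theorem norm_gradient_eq {n : ℕ} (f : Rn n → ℝ) (x : Rn n) : ‖gradient f x‖ = ‖fderiv ℝ f x‖ := by
  rw [gradient, LinearIsometryEquiv.norm_map]

theorem inner_gradient_left {n : ℕ} (f : Rn n → ℝ) (x v : Rn n) :
    inner ℝ (gradient f x) v = fderiv ℝ f x v := by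
  simp [gradient, InnerProductSpace.toDual_symm_apply]

theorem Cc.continuous_gradient {n : ℕ} (φ : Cc n) : Continuous (gradient φ) :=
  (InnerProductSpace.toDual ℝ (Rn n)).symm.continuous.comp
    (φ.contDiff.continuous_fderiv (by simp))

theorem IsWeakGradient.congr_grad {n : ℕ} {u : Rn n → ℝ} {g k : Rn n → Rn n}
    (hg : IsWeakGradient u g) (h : g =ᵐ[volume] k) : IsWeakGradient u k where
  locallyIntegrable_fun := hg.1
  locallyIntegrable_grad := hg.2.congr h
  integral_eq φ w := by
    rw [hg.3 φ w]
    congr 1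
    refine integral_congr_ae ?_
    filter_upwards [h] with x hx
    rw [hx]

theorem IsWeakGradient.sub {n : ℕ} {u v : Rn n → ℝ} {g k : Rn n → Rn n}
    (hg : IsWeakGradient u g) (hk : IsWeakGradient v k) : IsWeakGradient (u - v) (g - k) := by
  have := hg.add (hk.smul (-1))
  rwa [neg_one_smul, neg_one_smul, ← sub_eq_add_neg, ← sub_eq_add_neg] at this

/-- The Leibniz rule for the product of a weakly differentiable function and a test function. -/
theorem IsWeakGradient.mul_test {n : ℕ} {u : Rn n → ℝ} {g : Rn n → Rn n}
    (hg : IsWeakGradient u g) (η : Cc n) :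
    IsWeakGradient (fun x => η x * u x) (fun x => η x • g x + u x • gradient η x) := by
  have hη := η.continuous
  have hηc := η.hasCompactSupport
  have hgc : HasCompactSupport (gradient η) :=
    (hηc.fderiv ℝ).comp_left (g := (InnerProductSpace.toDual ℝ (Rn n)).symm) (map_zero _)
  refine ⟨?_, ?_, fun φ v => ?_⟩
  · exact (hg.1.integrable_smul_left_of_hasCompactSupport hη hηc).locallyIntegrable
  · exact ((hg.2.integrable_smul_left_of_hasCompactSupport hη hηc).add
      (hg.1.integrable_smul_right_of_hasCompactSupport η.continuous_gradient hgc)).locallyIntegrable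
  · let ψ : Cc n := ⟨fun x => η x * φ x, η.contDiff.mul φ.contDiff, hηc.mul_right, by simp⟩
    have hd : ∀ x, fderiv ℝ ψ x v = η x * fderiv ℝ φ x v + φ x * fderiv ℝ η x v := fun x => by
      change fderiv ℝ (fun x => η x * φ x) x v = _
      rw [fderiv_fun_mul (η.contDiff.differentiable (by simp) x)
        (φ.contDiff.differentiable (by simp) x)]
      simp
    have h := hg.3 ψ v
    obtain ⟨c1, k1⟩ := cc_fderiv φ v
    obtain ⟨c2, k2⟩ := cc_fderiv η v
    have i1 : Integrable fun x => u x * (η x * fderiv ℝ φ x v) :=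
      integrable_mul_cc hg.1 (hη.mul c1) hηc.mul_right
    have i2 : Integrable fun x => u x * (φ x * fderiv ℝ η x v) :=
      integrable_mul_cc hg.1 (φ.continuous.mul c2) φ.hasCompactSupport.mul_right
    have i3 : Integrable fun x => inner ℝ (g x) v * ψ x :=
      integrable_mul_cc (locInt_inner hg.2 v) ψ.continuous ψ.hasCompactSupport
    simp only [hd, mul_add] at h
    rw [integral_add i1 i2] at h
    have e1 : ∫ x, η x * u x * fderiv ℝ φ x v = ∫ x, u x * (η x * fderiv ℝ φ x v) :=
      integral_congr_ae (Eventually.of_forall fun x => by ring)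
    have e2 : ∫ x, inner ℝ (η x • g x + u x • gradient η x) v * φ x =
        ∫ x, (inner ℝ (g x) v * ψ x + u x * (φ x * fderiv ℝ η x v)) :=
      integral_congr_ae (Eventually.of_forall fun x => by
        change _ = inner ℝ (g x) v * (η x * φ x) + _
        simp only [inner_add_left, real_inner_smul_left, inner_gradient_left]; ring)
    rw [e1, e2, integral_add i3 i2]
    linarith

/-- Smooth cutoffs at every scale `R`, all dilates of one bump function; hence a bound of order
`1 / R` on their gradients. -/
theorem exists_cutoff (n : ℕ) : ∃ C : ℝ, 0 ≤ C ∧ ∀ R : ℝ, 0 < R → ∃ η : Cc n,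
    (∀ x, 0 ≤ η x ∧ η x ≤ 1) ∧ (∀ x, ‖x‖ ≤ R → η x = 1) ∧ (∀ x, ‖x‖ < R → gradient η x = 0) ∧
    (∀ x, 2 * R < ‖x‖ → gradient η x = 0) ∧ ∀ x, ‖gradient η x‖ ≤ C / R := by
  let f : ContDiffBump (0 : Rn n) := ⟨1, 2, one_pos, one_lt_two⟩
  have hfd : ContDiff ℝ 1 f := f.contDiff
  obtain ⟨C, hC⟩ := (hfd.continuous_fderiv one_ne_zero).bounded_above_of_compact_support
    (f.hasCompactSupport.fderiv ℝ)
  refine ⟨C, (norm_nonneg _).trans (hC 0), fun R hR => ?_⟩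
  have hR' : 0 < R⁻¹ := inv_pos.2 hR
  let η : Cc n := ⟨fun x => f (R⁻¹ • x), f.contDiff.comp (contDiff_const_smul _),
    f.hasCompactSupport.comp_smul hR'.ne', by simp⟩
  have hη : ∀ x, η x = f (R⁻¹ • x) := fun x => rfl
  have hnorm : ∀ x : Rn n, ‖R⁻¹ • x‖ = ‖x‖ / R := fun x => by
    rw [norm_smul, Real.norm_of_nonneg hR'.le, inv_mul_eq_div]
  have hone : ∀ x, ‖x‖ ≤ R → η x = 1 := fun x hx =>
    f.one_of_mem_closedBall (by
      rw [mem_closedBall_zero_iff, hnorm]; exact (div_le_one hR).2 hx)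
  have hzero : ∀ x, 2 * R < ‖x‖ → η x = 0 := fun x hx =>
    f.zero_of_le_dist (by
      rw [dist_zero_right, hnorm, le_div_iff₀ hR]; exact hx.le)
  have hloc : ∀ (c : ℝ) (x : Rn n), (∀ᶠ y in 𝓝 x, η y = c) → gradient η x = 0 := by
    intro c x h
    have e : fderiv ℝ η x = 0 := by
      have h' : (η : Rn n → ℝ) =ᶠ[𝓝 x] fun _ => c := h
      rw [h'.fderiv_eq]; simp
    rw [← norm_eq_zero, norm_gradient_eq, e, norm_zero]
  refine ⟨η, fun x => ⟨f.nonneg, f.le_one⟩, hone, fun x hx => hloc 1 x ?_,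
    fun x hx => hloc 0 x ?_, fun x => ?_⟩
  · filter_upwards [(isOpen_lt continuous_norm continuous_const).mem_nhds hx] with y hy
    exact hone y (le_of_lt hy)
  · filter_upwards [(isOpen_lt continuous_const continuous_norm).mem_nhds hx] with y hy
    exact hzero y hy
  · rw [norm_gradient_eq]
    change ‖fderiv ℝ (fun x => f (R⁻¹ • x)) x‖ ≤ _
    rw [fderiv_comp_smul, norm_smul, Real.norm_of_nonneg hR'.le, inv_mul_eq_div]
    gcongr
    exact hC _

/-! ### Density of test functions and the Sobolev inequality for the gradient -/

/-- The `L^n` norm of the gradient of a cutoff at scale `R` is bounded independently of `R`: the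
factor `1 / R` compensates the volume of the ball of radius `2 R`. -/
theorem eLpNorm_gradient_cutoff_le {n : ℕ} (hn : n ≠ 0) {C R : ℝ} (hR : 0 < R)
    {g : Rn n → Rn n} (h0 : ∀ x, 2 * R < ‖x‖ → g x = 0) (hg : ∀ x, ‖g x‖ ≤ C / R) :
    eLpNorm g n volume ≤
      volume (Metric.closedBall (0 : Rn n) 1) ^ (1 / (n : ℝ)) * ENNReal.ofReal (2 * C) := by
  have hn' : (n : ℝ) ≠ 0 := by exact_mod_cast hn
  have hsupp : Function.support g ⊆ Metric.closedBall 0 (2 * R) := by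
    intro x hx
    rw [mem_closedBall_zero_iff]
    by_contra h
    exact hx (h0 x (not_le.1 h))
  rw [← eLpNorm_restrict_eq_of_support_subset hsupp]
  refine (eLpNorm_le_of_ae_bound (C := C / R) (Eventually.of_forall hg)).trans_eq ?_
  rw [Measure.restrict_apply_univ, Measure.addHaar_closedBall' _ _ (by positivity),
    finrank_euclideanSpace_fin, ENNReal.mul_rpow_of_nonneg _ _ (by positivity)]
  have e : ENNReal.ofReal ((2 * R) ^ n) ^ ((n : ℝ≥0∞).toReal)⁻¹ = ENNReal.ofReal (2 * R) := by
    rw [ENNReal.toReal_natCast, ENNReal.ofReal_pow (by positivity), ← ENNReal.rpow_natCast,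
      ENNReal.rpow_rpow_inv hn']
  rw [e, ENNReal.toReal_natCast, one_div, mul_right_comm, mul_comm,
    ← ENNReal.ofReal_mul (by positivity)]
  congr 2
  field_simp

/-- Truncation with smooth cutoffs `η` of growing radius. The gradient of `u - η u` is
`(1 - η) ∇u - u ∇η`; the first term tends to `0` by dominated convergence, and the second by
Hölder's inequality with `1 / q + 1 / n = 1 / p`, since `∇η` is bounded in `L^n` and only the tail
of `u` meets its support. -/
theorem exists_hasCompactSupport_gradient_sub_le {n : ℕ} {p q : ℝ} (hp : 1 ≤ p) (hq : 0 < q)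
    (hn : n ≠ 0) (hqn : q⁻¹ + (n : ℝ)⁻¹ = p⁻¹) {u : Rn n → ℝ} {g : Rn n → Rn n}
    (hu : StronglyMeasurable u) (huq : MemLp u (ENNReal.ofReal q) volume)
    (hg : IsWeakGradient u g) (hgp : MemLp g (ENNReal.ofReal p) volume) {δ : ℝ≥0∞} (hδ : δ ≠ 0) :
    ∃ (v : Rn n → ℝ) (k : Rn n → Rn n), StronglyMeasurable v ∧ HasCompactSupport v ∧
      MemLp v (ENNReal.ofReal q) volume ∧ IsWeakGradient v k ∧
      MemLp k (ENNReal.ofReal p) volume ∧ eLpNorm (g - k) (ENNReal.ofReal p) volume ≤ δ ∧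
      eLpNorm (u - v) (ENNReal.ofReal q) volume ≤ δ := by
  have hp0 : 0 < p := by linarith
  have hn0 : 0 < (n : ℝ) := by exact_mod_cast Nat.pos_of_ne_zero hn
  have hp' : ENNReal.ofReal p ≠ 0 := by simpa using hp0
  have hq' : ENNReal.ofReal q ≠ 0 := by simpa using hq
  have hp1 : 1 ≤ ENNReal.ofReal p := by simpa using hp
  have hHolder : ENNReal.HolderTriple (ENNReal.ofReal q) n (ENNReal.ofReal p) := by
    refine ⟨?_⟩
    have : (n : ℝ≥0∞) = ENNReal.ofReal (n : ℝ) := by simp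
    rw [this, ← ENNReal.ofReal_inv_of_pos hq, ← ENNReal.ofReal_inv_of_pos hn0,
      ← ENNReal.ofReal_inv_of_pos hp0, ← ENNReal.ofReal_add (by positivity) (by positivity), hqn]
  obtain ⟨C, hC, hcut⟩ := exists_cutoff n
  have hk0 : ∀ k : ℕ, (0 : ℝ) < (k : ℝ) + 1 := fun k => by positivity
  choose η hη01 hη1 hηg hηg' hηC using fun k : ℕ => hcut ((k : ℝ) + 1) (hk0 k)
  have hlarge : ∀ x : Rn n, ∀ᶠ k : ℕ in atTop, ‖x‖ < (k : ℝ) + 1 := by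
    intro x
    filter_upwards [eventually_ge_atTop ⌈‖x‖⌉₊] with k hk
    have := Nat.le_ceil ‖x‖
    have h2 : (⌈‖x‖⌉₊ : ℝ) ≤ k := by exact_mod_cast hk
    linarith
  have habs : ∀ k x, |1 - η k x| ≤ 1 := fun k x => by
    rw [abs_le]; constructor <;> linarith [(hη01 k x).1, (hη01 k x).2]
  have hηlim : ∀ x, ∀ᶠ k in atTop, 1 - η k x = 0 := fun x =>
    (hlarge x).mono fun k hk => by rw [hη1 k x hk.le, sub_self]
  have t1 : Tendsto (fun k => eLpNorm (fun x => (1 - η k x) * u x) (ENNReal.ofReal q) volume)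
      atTop (𝓝 0) := by
    refine tendsto_eLpNorm_zero_of_dominated hq' ENNReal.ofReal_ne_top (fun k => ?_) huq
      (fun k x => ?_) fun x => ?_
    · exact ((continuous_const.sub (η k).continuous).aestronglyMeasurable).mul huq.1
    · rw [norm_mul]; exact mul_le_of_le_one_left (norm_nonneg _) (habs k x)
    · exact tendsto_const_nhds.congr' ((hηlim x).mono fun k hk => by simp [hk])
  have t2 : Tendsto (fun k => eLpNorm (fun x => (1 - η k x) • g x) (ENNReal.ofReal p) volume)
      atTop (𝓝 0) := by
    refine tendsto_eLpNorm_zero_of_dominated hp' ENNReal.ofReal_ne_top (fun k => ?_) hgp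
      (fun k x => ?_) fun x => ?_
    · exact ((continuous_const.sub (η k).continuous).aestronglyMeasurable).smul hgp.1
    · rw [norm_smul]; exact mul_le_of_le_one_left (norm_nonneg _) (habs k x)
    · exact tendsto_const_nhds.congr' ((hηlim x).mono fun k hk => by simp [hk])
  set S : ℕ → Set (Rn n) := fun k => {x | (k : ℝ) + 1 ≤ ‖x‖} with hS
  have hSm : ∀ k, MeasurableSet (S k) := fun k => measurableSet_le measurable_const measurable_norm
  have t3 : Tendsto (fun k => eLpNorm ((S k).indicator u) (ENNReal.ofReal q) volume)
      atTop (𝓝 0) := by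
    refine tendsto_eLpNorm_zero_of_dominated hq' ENNReal.ofReal_ne_top (fun k => ?_) huq
      (fun k x => norm_indicator_le_norm_self _ _) fun x => ?_
    · exact huq.1.indicator (hSm k)
    · refine tendsto_const_nhds.congr' ((hlarge x).mono fun k hk => ?_)
      have hx : x ∉ S k := not_le.2 hk
      exact (indicator_of_notMem hx u).symm
  set M : ℝ≥0∞ := volume (Metric.closedBall (0 : Rn n) 1) ^ (1 / (n : ℝ)) * ENNReal.ofReal (2 * C)
    with hM
  have hMtop : M ≠ ∞ := ENNReal.mul_ne_top
    (ENNReal.rpow_ne_top_of_nonneg (by positivity) measure_closedBall_lt_top.ne)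
    ENNReal.ofReal_ne_top
  have t4 : Tendsto (fun k => eLpNorm (fun x => u x • gradient (η k) x) (ENNReal.ofReal p) volume)
      atTop (𝓝 0) := by
    have h := ENNReal.Tendsto.mul_const t3 (Or.inr hMtop)
    rw [zero_mul] at h
    refine tendsto_of_tendsto_of_tendsto_of_le_of_le tendsto_const_nhds h (fun _ => zero_le)
      fun k => ?_
    have e : (fun x => u x • gradient (η k) x) = (S k).indicator u • gradient (η k) := by
      funext x
      rw [Pi.smul_apply']
      by_cases hx : x ∈ S k
      · rw [indicator_of_mem hx]
      · rw [hηg k x (not_le.1 hx), smul_zero, smul_zero]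
    change eLpNorm (fun x => u x • gradient (η k) x) _ _ ≤ _
    rw [e]
    refine (eLpNorm_smul_le_mul_eLpNorm (p := ENNReal.ofReal q) (q := n) (η k).continuous_gradient.aestronglyMeasurable
      (huq.1.indicator (hSm k))).trans ?_
    gcongr
    exact eLpNorm_gradient_cutoff_le hn (hk0 k) (hηg' k) (hηC k)
  have t24 := t2.add t4
  rw [add_zero] at t24
  obtain ⟨k, hk1, hk2⟩ := ((t1.eventually_le_const (pos_iff_ne_zero.2 hδ)).and
    (t24.eventually_le_const (pos_iff_ne_zero.2 hδ))).exists
  have hηm := (η k).continuous.aestronglyMeasurable (μ := (volume : Measure (Rn n)))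
  have m2 : AEStronglyMeasurable (fun x => (1 - η k x) • g x) volume :=
    (aestronglyMeasurable_const.sub hηm).smul hgp.1
  have m4 : AEStronglyMeasurable (fun x => u x • gradient (η k) x) volume :=
    huq.1.smul (η k).continuous_gradient.aestronglyMeasurable
  have hdiff : g - (fun x => η k x • g x + u x • gradient (η k) x) =
      (fun x => (1 - η k x) • g x) - fun x => u x • gradient (η k) x := by
    funext x
    simp only [Pi.sub_apply, sub_smul, one_smul]; abel
  have hle : eLpNorm (g - fun x => η k x • g x + u x • gradient (η k) x) (ENNReal.ofReal p)
      volume ≤ eLpNorm (fun x => (1 - η k x) • g x) (ENNReal.ofReal p) volume +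
        eLpNorm (fun x => u x • gradient (η k) x) (ENNReal.ofReal p) volume := by
    rw [hdiff]; exact eLpNorm_sub_le m2 m4 hp1
  refine ⟨fun x => η k x * u x, fun x => η k x • g x + u x • gradient (η k) x,
    (η k).continuous.stronglyMeasurable.mul hu, (η k).hasCompactSupport.mul_right, ?_,
    hg.mul_test (η k), ?_, hle.trans hk2, ?_⟩
  · refine huq.of_le (hηm.mul huq.1) (Eventually.of_forall fun x => ?_)
    rw [norm_mul]
    refine mul_le_of_le_one_left (norm_nonneg _) ?_
    rw [Real.norm_eq_abs, abs_of_nonneg (hη01 k x).1]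
    exact (hη01 k x).2
  · refine MemLp.add ?_ ⟨m4, ?_⟩
    · refine hgp.of_le (hηm.smul hgp.1) (Eventually.of_forall fun x => ?_)
      rw [norm_smul]
      refine mul_le_of_le_one_left (norm_nonneg _) ?_
      rw [Real.norm_eq_abs, abs_of_nonneg (hη01 k x).1]
      exact (hη01 k x).2
    · have e : (fun x => u x • gradient (η k) x) = u • gradient (η k) := rfl
      rw [e]
      refine (eLpNorm_smul_le_mul_eLpNorm (p := ENNReal.ofReal q) (q := n)
        (η k).continuous_gradient.aestronglyMeasurable huq.1).trans_lt ?_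
      exact ENNReal.mul_lt_top huq.eLpNorm_lt_top
        ((eLpNorm_gradient_cutoff_le hn (hk0 k) (hηg' k) (hηC k)).trans_lt hMtop.lt_top)
  · refine le_of_eq_of_le ?_ hk1
    congr 1
    funext x
    simp only [Pi.sub_apply]; ring

/-- The gradient of a mollification is the mollification of the weak gradient: test the weak
gradient with the translated and reflected mollifier `y ↦ ρ (x - y)`. -/
theorem gradient_mollify {n : ℕ} (b : ContDiffBump (0 : Rn n)) {v : Rn n → ℝ} {g : Rn n → Rn n}
    (hg : IsWeakGradient v g) (x : Rn n) :
    gradient (fun x => ∫ h, b.normed volume h • v (x - h)) x =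
      ∫ h, b.normed volume h • g (x - h) := by
  have hbc := b.hasCompactSupport_normed (μ := volume)
  have hb1 : ContDiff ℝ 1 (b.normed volume) := b.contDiff_normed
  have hint : Integrable fun h => b.normed volume h • g (x - h) :=
    hbc.convolutionExists_left (ContinuousLinearMap.lsmul ℝ ℝ) b.continuous_normed hg.2 x
  refine ext_inner_right ℝ fun w => ?_
  rw [inner_gradient_left]
  have hder := hbc.hasFDerivAt_convolution_left (ContinuousLinearMap.lsmul ℝ ℝ : ℝ →L[ℝ] ℝ →L[ℝ] ℝ)
    hb1 hg.1 x
  have e1 := hder.fderiv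
  change fderiv ℝ (fun x => ∫ h, b.normed volume h • v (x - h)) x = _ at e1
  rw [e1, convolution_def]
  have hcint := (hbc.fderiv ℝ).convolutionExists_left
    ((ContinuousLinearMap.lsmul ℝ ℝ : ℝ →L[ℝ] ℝ →L[ℝ] ℝ).precompL (Rn n))
    (hb1.continuous_fderiv one_ne_zero) hg.1 x
  rw [ContinuousLinearMap.integral_apply hcint]
  let φ : Cc n := ⟨fun y => b.normed volume (x - y),
    b.contDiff_normed.comp (contDiff_const.sub contDiff_id),
    hbc.comp_homeomorph (Homeomorph.subLeft x), by simp⟩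
  have hφ : ∀ y, φ y = b.normed volume (x - y) := fun y => rfl
  have hφd : ∀ y, fderiv ℝ φ y w = - fderiv ℝ (b.normed volume) (x - y) w := by
    intro y
    have h1 : HasFDerivAt (fun y : Rn n => x - y) (-ContinuousLinearMap.id ℝ (Rn n)) y :=
      (hasFDerivAt_id y).const_sub x
    have h2 := ((hb1.differentiable one_ne_zero) (x - y)).hasFDerivAt.comp y h1
    have h3 : fderiv ℝ φ y = _ := h2.fderiv
    rw [h3]; simp
  have h := hg.3 φ w
  calc _ = ∫ t, fderiv ℝ (b.normed volume) t w * v (x - t) := rfl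
    _ = ∫ y, fderiv ℝ (b.normed volume) (x - y) w * v y := by
        rw [← integral_sub_left_eq_self (fun t => fderiv ℝ (b.normed volume) t w * v (x - t))
          volume x]
        simp
    _ = - ∫ y, v y * fderiv ℝ φ y w := by
        rw [← integral_neg]
        refine integral_congr_ae (Eventually.of_forall fun y => ?_)
        simp only [hφd]; ring
    _ = ∫ y, inner ℝ (g y) w * φ y := by rw [h, neg_neg]
    _ = ∫ t, inner ℝ (b.normed volume t • g (x - t)) w := by
        rw [← integral_sub_left_eq_self (fun y => inner ℝ (g y) w * φ y) volume x]
        refine integral_congr_ae (Eventually.of_forall fun y => ?_)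
        simp only [hφ, sub_sub_cancel, real_inner_smul_left]; ring
    _ = _ := by
        rw [real_inner_comm, ← integral_inner hint w]
        exact integral_congr_ae (Eventually.of_forall fun t => real_inner_comm _ _)

/-- Test functions approximate `u` simultaneously in `L^q` and in the gradient norm. Convergence in
`L^q` is what allows the Sobolev inequality to pass from test functions to `u`. -/
theorem exists_test_gradient_sub_le {n : ℕ} {p q : ℝ} (hp : 1 ≤ p) (hpq : p ≤ q)
    (hn : n ≠ 0) (hqn : q⁻¹ + (n : ℝ)⁻¹ = p⁻¹) {u : Rn n → ℝ} {g : Rn n → Rn n}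
    (hu : StronglyMeasurable u) (huq : MemLp u (ENNReal.ofReal q) volume)
    (hg : IsWeakGradient u g) (hgp : MemLp g (ENNReal.ofReal p) volume) {δ : ℝ≥0∞} (hδ : δ ≠ 0) :
    ∃ φ : Cc n, eLpNorm (g - gradient φ) (ENNReal.ofReal p) volume ≤ δ ∧
      eLpNorm (u - ⇑φ) (ENNReal.ofReal q) volume ≤ δ := by
  have hp1 : 1 ≤ ENNReal.ofReal p := by simpa using hp
  have hq1 : 1 ≤ ENNReal.ofReal q := by simpa using hp.trans hpq
  have hδ2 : δ / 2 ≠ 0 := by simpa using hδ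
  obtain ⟨v, k, hv, hvc, hvq, hk, hkp, hgk, huv⟩ := exists_hasCompactSupport_gradient_sub_le hp
    (by linarith) hn hqn hu huq hg hgp hδ2
  have hkk' := hkp.1.ae_eq_mk
  set k' := hkp.1.mk k with hk'
  have hk'm : StronglyMeasurable k' := hkp.1.stronglyMeasurable_mk
  have hk'g : IsWeakGradient v k' := hk.congr_grad hkk'
  have hk'p : MemLp k' (ENNReal.ofReal p) volume := (memLp_congr_ae hkk').1 hkp
  obtain ⟨r₁, hr₁, h₁⟩ := exists_eLpNorm_mollify_sub_le (μ := (volume : Measure (Rn n))) hp1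
    ENNReal.ofReal_ne_top (ι := fun h : Rn n => h) (by fun_prop) rfl hk'm hk'p hδ2
  obtain ⟨r₂, hr₂, h₂⟩ := exists_eLpNorm_mollify_sub_le (μ := (volume : Measure (Rn n))) hq1
    ENNReal.ofReal_ne_top (ι := fun h : Rn n => h) (by fun_prop) rfl hv hvq hδ2
  set r := min r₁ r₂ with hr
  have hr0 : 0 < r := lt_min hr₁ hr₂
  let b : ContDiffBump (0 : Rn n) := ⟨r / 4, r / 2, by positivity, by linarith⟩
  have hbr : b.rOut < r := by change r / 2 < r; linarith
  obtain ⟨ψ, hψ⟩ := exists_test_eq_mollify b hk.1 hvc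
  have e : (ψ : Rn n → ℝ) = fun x => ∫ h, b.normed volume h • v (x - h) := funext hψ
  have hb1 := h₁ b (hbr.trans_le (min_le_left _ _))
  have hb2 := h₂ b (hbr.trans_le (min_le_right _ _))
  have hψm : StronglyMeasurable ψ := ψ.continuous.stronglyMeasurable
  refine ⟨ψ, ?_, ?_⟩
  · have e1 : g - gradient ψ = (g - k) + (k - gradient ψ) := by abel
    have e2 : eLpNorm (k - gradient ψ) (ENNReal.ofReal p) volume ≤ δ / 2 := by
      have e3 : gradient ψ = fun x => ∫ h, b.normed volume h • k' (x - h) := by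
        funext x; rw [e, gradient_mollify b hk'g]
      rw [eLpNorm_congr_ae (hkk'.sub (EventuallyEq.refl _ (gradient ψ))), eLpNorm_sub_comm, e3]
      exact hb1
    rw [e1]
    refine (eLpNorm_add_le (hgp.1.sub hkp.1)
      (hkp.1.sub ψ.continuous_gradient.aestronglyMeasurable) hp1).trans ?_
    exact (add_le_add hgk e2).trans_eq (ENNReal.add_halves δ)
  · have e1 : u - ⇑ψ = (u - v) + (v - ⇑ψ) := by abel
    have e2 : eLpNorm (v - ⇑ψ) (ENNReal.ofReal q) volume ≤ δ / 2 := by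
      rw [eLpNorm_sub_comm, e]
      exact hb2
    rw [e1]
    refine (eLpNorm_add_le (hu.sub hv).aestronglyMeasurable
      (hv.sub hψm).aestronglyMeasurable hq1).trans ?_
    exact (add_le_add huv e2).trans_eq (ENNReal.add_halves δ)

/-- The Gagliardo–Nirenberg–Sobolev inequality for functions of `L^q` with weak gradient in `L^p`,
obtained by density from the one for test functions. -/
theorem exists_eLpNorm_le_mul_gradient {n : ℕ} {p q : ℝ} (hp : 1 ≤ p) (hpq : p ≤ q)
    (hn : n ≠ 0) (hqn : q⁻¹ + (n : ℝ)⁻¹ = p⁻¹) :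
    ∃ C : ℝ≥0∞, C ≠ ∞ ∧ ∀ (u : Rn n → ℝ) (g : Rn n → Rn n), StronglyMeasurable u →
      MemLp u (ENNReal.ofReal q) volume → IsWeakGradient u g →
      MemLp g (ENNReal.ofReal p) volume →
      eLpNorm u (ENNReal.ofReal q) volume ≤ C * eLpNorm g (ENNReal.ofReal p) volume := by
  have hp0 : 0 < p := by linarith
  have hp1 : 1 ≤ ENNReal.ofReal p := by simpa using hp
  have hq1 : 1 ≤ ENNReal.ofReal q := by simpa using hp.trans hpq
  set C := SNormLESNormFDerivOfEqConst ℝ (volume : Measure (Rn n)) p.toNNReal with hC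
  have hGNS : ∀ φ : Cc n, eLpNorm φ (ENNReal.ofReal q) volume ≤
      C * eLpNorm (gradient φ) (ENNReal.ofReal p) volume := by
    intro φ
    have h := eLpNorm_le_eLpNorm_fderiv_of_eq (volume : Measure (Rn n)) (u := φ)
      (φ.contDiff.of_le (by simp)) φ.hasCompactSupport (p := p.toNNReal) (p' := q.toNNReal)
      (by simpa using hp) (by rw [finrank_euclideanSpace_fin]; exact Nat.pos_of_ne_zero hn)
      (by rw [finrank_euclideanSpace_fin, Real.coe_toNNReal _ (by linarith),
            NNReal.coe_inv, Real.coe_toNNReal _ hp0.le]; linarith)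
    refine h.trans_eq ?_
    congr 1
    exact eLpNorm_congr_norm_ae (Eventually.of_forall fun x => (norm_gradient_eq φ x).symm)
  refine ⟨C, ENNReal.coe_ne_top, fun u g hu huq hg hgp => ?_⟩
  have key : ∀ δ : ℝ≥0∞, δ ≠ 0 → eLpNorm u (ENNReal.ofReal q) volume ≤
      δ + C * (eLpNorm g (ENNReal.ofReal p) volume + δ) := by
    intro δ hδ
    obtain ⟨φ, h1, h2⟩ := exists_test_gradient_sub_le hp hpq hn hqn hu huq hg hgp hδ
    have m1 := φ.continuous_gradient.aestronglyMeasurable (μ := (volume : Measure (Rn n)))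
    have e1 : u = (u - ⇑φ) + ⇑φ := by abel
    have e2 : gradient φ = g - (g - gradient φ) := by abel
    calc eLpNorm u (ENNReal.ofReal q) volume
        = eLpNorm ((u - ⇑φ) + ⇑φ) (ENNReal.ofReal q) volume := by rw [← e1]
      _ ≤ eLpNorm (u - ⇑φ) (ENNReal.ofReal q) volume + eLpNorm φ (ENNReal.ofReal q) volume :=
          eLpNorm_add_le (huq.1.sub φ.continuous.aestronglyMeasurable)
            φ.continuous.aestronglyMeasurable hq1
      _ ≤ δ + C * eLpNorm (gradient φ) (ENNReal.ofReal p) volume := add_le_add h2 (hGNS φ)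
      _ ≤ δ + C * (eLpNorm g (ENNReal.ofReal p) volume + δ) := by
          gcongr
          calc eLpNorm (gradient φ) (ENNReal.ofReal p) volume
              = eLpNorm (g - (g - gradient φ)) (ENNReal.ofReal p) volume := by rw [← e2]
            _ ≤ _ := eLpNorm_sub_le hgp.1 (hgp.1.sub m1) hp1
            _ ≤ _ := by gcongr
  have hlim : Tendsto (fun δ : ℝ≥0∞ => δ + C * (eLpNorm g (ENNReal.ofReal p) volume + δ))
      (𝓝[>] 0) (𝓝 (0 + C * (eLpNorm g (ENNReal.ofReal p) volume + 0))) := by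
    refine Tendsto.mono_left ?_ nhdsWithin_le_nhds
    exact tendsto_id.add (ENNReal.Tendsto.const_mul (tendsto_const_nhds.add tendsto_id)
      (Or.inr ENNReal.coe_ne_top))
  rw [zero_add, add_zero] at hlim
  exact ge_of_tendsto hlim (eventually_nhdsWithin_of_forall fun δ hδ => key δ (ne_of_gt hδ))

/-! ### The two cases combined -/

theorem mul_ofReal_rpow_ne {s p : ℝ} (hs0 : 0 < s) (hs1 : s < 1) (hp : 1 ≤ p) :
    ENNReal.ofReal (s * (1 - s)) ^ (1 / p) ≠ 0 ∧ ENNReal.ofReal (s * (1 - s)) ^ (1 / p) ≠ ∞ := by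
  have hp0 : 0 < p := by linarith
  have h : 0 < s * (1 - s) := mul_pos hs0 (by linarith)
  exact ⟨(ENNReal.rpow_pos (ENNReal.ofReal_pos.2 h) ENNReal.ofReal_ne_top).ne', by finiteness⟩

theorem memLp_quot_of_seminormW_lt_top {n : ℕ} {s p : ℝ} (hs0 : 0 < s) (hs1 : s < 1) (hp : 1 ≤ p)
    {u : Rn n → ℝ} (hu : AEStronglyMeasurable u volume) (h : seminormW n s p u < ∞) :
    MemLp (quot n s p u) (ENNReal.ofReal p) volume := by
  refine ⟨quot_aesm hu, ?_⟩
  rw [seminormW_of_ne hs1.ne hp] at h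
  exact ENNReal.lt_top_of_mul_ne_top_right h.ne (mul_ofReal_rpow_ne hs0 hs1 hp).1

theorem exists_isWeakGradient_of_seminormW_lt_top {n : ℕ} {p : ℝ} {u : Rn n → ℝ}
    (h : seminormW n 1 p u < ∞) :
    ∃ g, IsWeakGradient u g ∧ MemLp g (ENNReal.ofReal p) volume := by
  rw [seminormW, if_pos rfl, gradientNorm] at h
  obtain ⟨g, hg⟩ := iInf_lt_iff.1 h
  obtain ⟨hg1, hg2⟩ := iInf_lt_iff.1 hg
  exact ⟨g, hg1, hg1.2.aestronglyMeasurable, hg2⟩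

theorem seminormW_one_eq {n : ℕ} {p : ℝ} {u : Rn n → ℝ} {g : Rn n → Rn n}
    (hg : IsWeakGradient u g) : seminormW n 1 p u = eLpNorm g (ENNReal.ofReal p) volume := by
  rw [seminormW, if_pos rfl, gradientNorm_eq hg]

theorem exponent_facts {n : ℕ} {s p : ℝ} (hs0 : 0 < s) (hp : 1 ≤ p) (hsp : s * p < n) :
    n ≠ 0 ∧ p ≤ (n : ℝ) * p / (n - s * p) ∧
      ((n : ℝ) * p / (n - s * p))⁻¹ + s * (n : ℝ)⁻¹ = p⁻¹ := by
  have hp0 : 0 < p := by linarith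
  have hn0 : 0 < (n : ℝ) := by nlinarith [mul_pos hs0 hp0]
  refine ⟨by exact_mod_cast hn0.ne', ?_, ?_⟩
  · rw [le_div_iff₀ (by linarith)]; nlinarith [mul_pos hs0 hp0]
  · rw [inv_div]; field_simp; ring

/-- The Sobolev inequality `‖u‖_q ≤ C [u]_{W^{s,p}}` for all `s ∈ (0, 1]`. -/
theorem exists_eLpNorm_le_mul_seminormW {n : ℕ} {s p : ℝ} (hs0 : 0 < s) (hs1 : s ≤ 1) (hp : 1 ≤ p)
    (hsp : s * p < n) : ∃ C : ℝ≥0∞, C ≠ ∞ ∧ ∀ u : Rn n → ℝ, StronglyMeasurable u →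
      MemLp u (critExp n s p) volume → seminormW n s p u < ∞ →
      eLpNorm u (critExp n s p) volume ≤ C * seminormW n s p u := by
  rcases hs1.eq_or_lt with rfl | hs1
  · obtain ⟨hn, hpq, he⟩ := exponent_facts hs0 hp hsp
    rw [one_mul (n : ℝ)⁻¹] at he
    obtain ⟨C, hC, h⟩ := exists_eLpNorm_le_mul_gradient hp hpq hn he
    refine ⟨C, hC, fun u hu huq hfin => ?_⟩
    obtain ⟨g, hg, hgp⟩ := exists_isWeakGradient_of_seminormW_lt_top hfin
    rw [seminormW_one_eq hg]
    exact h u g hu huq hg hgp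
  · obtain ⟨C, hC, h⟩ := exists_eLpNorm_le_mul_eLpNorm_quot hs0 hp hsp
    obtain ⟨hκ0, hκ⟩ := mul_ofReal_rpow_ne hs0 hs1 hp
    refine ⟨C * (ENNReal.ofReal (s * (1 - s)) ^ (1 / p))⁻¹,
      ENNReal.mul_ne_top hC (ENNReal.inv_ne_top.2 hκ0), fun u hu huq _ => ?_⟩
    rw [seminormW_of_ne hs1.ne hp, mul_assoc, ← mul_assoc _⁻¹, ENNReal.inv_mul_cancel hκ0 hκ,
      one_mul]
    exact h u hu huq

/-- Test functions are dense for the seminorm `[·]_{W^{s,p}}`, for all `s ∈ (0, 1]`. -/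
theorem exists_test_seminormW_sub_le {n : ℕ} {s p : ℝ} (hs0 : 0 < s) (hs1 : s ≤ 1) (hp : 1 ≤ p)
    (hsp : s * p < n) {u : Rn n → ℝ} (hu : StronglyMeasurable u)
    (huq : MemLp u (critExp n s p) volume) (hfin : seminormW n s p u < ∞) {δ : ℝ≥0∞}
    (hδ : δ ≠ 0) : ∃ φ : Cc n, seminormW n s p (u - φ) ≤ δ := by
  rcases hs1.eq_or_lt with rfl | hs1
  · obtain ⟨hn, hpq, he⟩ := exponent_facts hs0 hp hsp
    rw [one_mul (n : ℝ)⁻¹] at he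
    obtain ⟨g, hg, hgp⟩ := exists_isWeakGradient_of_seminormW_lt_top hfin
    obtain ⟨φ, hφ, -⟩ := exists_test_gradient_sub_le hp hpq hn he hu huq hg hgp hδ
    exact ⟨φ, by rwa [seminormW_one_eq (hg.sub (isWeakGradient_cc φ))]⟩
  · obtain ⟨hκ0, hκ⟩ := mul_ofReal_rpow_ne hs0 hs1 hp
    obtain ⟨φ, hφ⟩ := exists_test_quot_sub_le hs0 hs1 hp hsp hu huq
      (memLp_quot_of_seminormW_lt_top hs0 hs1 hp hu.aestronglyMeasurable hfin)
      (δ := δ / ENNReal.ofReal (s * (1 - s)) ^ (1 / p)) (ENNReal.div_pos hδ hκ).ne'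
    refine ⟨φ, ?_⟩
    rw [seminormW_of_ne hs1.ne hp, mul_comm]
    exact (ENNReal.le_div_iff_mul_le (Or.inl hκ0) (Or.inl hκ)).1 hφ

/-! ### Completeness -/

theorem tendsto_integral_smul_of_tendsto_Lp {n : ℕ} {E : Type*} [NormedAddCommGroup E]
    [NormedSpace ℝ E] {p : ℝ≥0∞} [Fact (1 ≤ p)] {f : ℕ → Lp E p (volume : Measure (Rn n))}
    {f₀ : Lp E p (volume : Measure (Rn n))} (hf : Tendsto f atTop (𝓝 f₀)) {ψ : Rn n → ℝ}
    (hψ : Continuous ψ) (hc : HasCompactSupport ψ) :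
    Tendsto (fun k => ∫ x, ψ x • f k x) atTop (𝓝 (∫ x, ψ x • f₀ x)) := by
  have hp1 : 1 ≤ p := Fact.out
  have hloc : ∀ g : Lp E p (volume : Measure (Rn n)), LocallyIntegrable g := fun g =>
    (Lp.memLp g).locallyIntegrable hp1
  have hint : ∀ g : Lp E p (volume : Measure (Rn n)), Integrable fun x => ψ x • g x := fun g =>
    (hloc g).integrable_smul_left_of_hasCompactSupport hψ hc
  have hψL : MemLp ψ p.conjExponent volume := hψ.memLp_of_hasCompactSupport hc
  refine tendsto_integral_of_L1' _ (hint f₀).aestronglyMeasurable (Eventually.of_forall fun k => hint (f k)) ?_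
  have hH : ENNReal.HolderTriple p.conjExponent p 1 :=
    (ENNReal.HolderConjugate.conjExponent hp1).symm
  have h0 : Tendsto (fun k => eLpNorm (f k - f₀ : Rn n → E) p volume) atTop (𝓝 0) :=
    (Lp.tendsto_Lp_iff_tendsto_eLpNorm' f f₀).1 hf
  have h1 := ENNReal.Tendsto.const_mul (a := eLpNorm ψ p.conjExponent volume) h0
    (Or.inr hψL.eLpNorm_lt_top.ne)
  rw [mul_zero] at h1
  refine tendsto_of_tendsto_of_tendsto_of_le_of_le tendsto_const_nhds h1 (fun _ => zero_le)
    fun k => ?_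
  have e : (fun x => ψ x • f k x) - (fun x => ψ x • f₀ x) = ψ • (f k - f₀ : Rn n → E) := by
    funext x
    simp [smul_sub]
  change eLpNorm ((fun x => ψ x • f k x) - fun x => ψ x • f₀ x) 1 volume ≤ _
  rw [e]
  exact eLpNorm_smul_le_mul_eLpNorm
    ((Lp.aestronglyMeasurable _).sub (Lp.aestronglyMeasurable _)) hψL.1

/-- The weak gradient is a closed operator. -/
theorem isWeakGradient_of_tendsto {n : ℕ} {p q : ℝ≥0∞} [Fact (1 ≤ p)] [Fact (1 ≤ q)]
    {u : ℕ → Lp ℝ q (volume : Measure (Rn n))} {u₀ : Lp ℝ q (volume : Measure (Rn n))}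
    {g : ℕ → Lp (Rn n) p (volume : Measure (Rn n))} {g₀ : Lp (Rn n) p (volume : Measure (Rn n))}
    (hu : Tendsto u atTop (𝓝 u₀)) (hg : Tendsto g atTop (𝓝 g₀))
    (h : ∀ k, IsWeakGradient (u k) (g k)) : IsWeakGradient u₀ g₀ := by
  refine ⟨(Lp.memLp u₀).locallyIntegrable Fact.out, (Lp.memLp g₀).locallyIntegrable Fact.out,
    fun φ v => ?_⟩
  obtain ⟨c, k⟩ := cc_fderiv φ v
  have e : ∀ G : Lp (Rn n) p (volume : Measure (Rn n)),
      ∫ x, inner ℝ (G x) v * φ x = inner ℝ v (∫ x, φ x • G x) := by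
    intro G
    have hint : Integrable fun x => φ x • G x :=
      ((Lp.memLp G).locallyIntegrable Fact.out).integrable_smul_left_of_hasCompactSupport
        φ.continuous φ.hasCompactSupport
    rw [← integral_inner hint v]
    refine integral_congr_ae (Eventually.of_forall fun x => ?_)
    simp only [real_inner_smul_right, real_inner_comm]; ring
  have h1 := tendsto_integral_smul_of_tendsto_Lp hu c k
  have h2 := (tendsto_const_nhds (x := v)).inner (𝕜 := ℝ)
    (tendsto_integral_smul_of_tendsto_Lp hg φ.continuous φ.hasCompactSupport)
  have h3 : ∀ k, ∫ x, fderiv ℝ φ x v • u k x = - inner ℝ v (∫ x, φ x • g k x) := fun k => by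
    rw [← e, ← (h k).3 φ v]
    exact integral_congr_ae (Eventually.of_forall fun x => by simp [mul_comm])
  have h4 := tendsto_nhds_unique h1 (h2.neg.congr fun k => (h3 k).symm)
  rw [e, ← h4]
  exact integral_congr_ae (Eventually.of_forall fun x => by simp [mul_comm])

namespace DotW

variable {n : ℕ} {s p : ℝ} {hp : 1 ≤ p}

theorem toLp_sub (u v : DotW n s p hp) : (u - v).toLp = u.toLp - v.toLp := rfl

theorem norm_sub_eq (u v : DotW n s p hp) :
    ‖u - v‖ = (seminormW n s p ((u.toLp : Rn n → ℝ) - v.toLp)).toReal := by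
  rw [norm_def, toLp_sub, seminormW_congr hp (Lp.coeFn_sub _ _)]

/-- A map from `Ẇ^{s,p}` to a normed space `E` that computes the distance up to the positive factor
`const`, and whose values are stable under limits: if `u k → v` in `L^q` and the images converge,
then their limit is again a value of the map. The weak gradient (`s = 1`) and the difference
quotient (`s < 1`) are of this kind, with an `L^p` space as `E`. -/
structure ClosedDerivative (n : ℕ) (s p : ℝ) (hp : 1 ≤ p) [Fact (1 ≤ critExp n s p)]
    (E : Type*) [NormedAddCommGroup E] where
  toFun : DotW n s p hp → E
  const : ℝ
  const_pos : 0 < const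
  norm_sub : ∀ u v : DotW n s p hp, ‖u - v‖ = const * ‖toFun u - toFun v‖
  closed : ∀ (u : ℕ → DotW n s p hp) (v : Lp ℝ (critExp n s p) volume) (G : E),
    Tendsto (fun k => (u k).toLp) atTop (𝓝 v) → Tendsto (fun k => toFun (u k)) atTop (𝓝 G) →
    ∃ w, toFun w = G

/-- By the Sobolev inequality a Cauchy sequence of `Ẇ^{s,p}` is also Cauchy in `L^q`, so that
closedness applies to it. -/
theorem ClosedDerivative.completeSpace [Fact (1 ≤ critExp n s p)] {E : Type*}
    [NormedAddCommGroup E] [CompleteSpace E] (D : ClosedDerivative n s p hp E) {C : ℝ}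
    (hC0 : 0 ≤ C) (hC : ∀ u : DotW n s p hp, ‖u.toLp‖ ≤ C * ‖u‖) :
    CompleteSpace (DotW n s p hp) := by
  refine Metric.complete_of_cauchySeq_tendsto fun u hu => ?_
  have l1 : LipschitzWith C.toNNReal (toLp : DotW n s p hp → _) :=
    LipschitzWith.of_dist_le_mul fun a b => by
      rw [dist_eq_norm, dist_eq_norm, Real.coe_toNNReal _ hC0]; exact hC (a - b)
  have l2 : LipschitzWith (D.const⁻¹).toNNReal D.toFun :=
    LipschitzWith.of_dist_le_mul fun a b => by
      rw [dist_eq_norm, dist_eq_norm, Real.coe_toNNReal _ (inv_nonneg.2 D.const_pos.le),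
        D.norm_sub, inv_mul_cancel_left₀ D.const_pos.ne']
  obtain ⟨v, hv⟩ := cauchySeq_tendsto_of_complete (l1.uniformContinuous.comp_cauchySeq hu)
  obtain ⟨G, hG⟩ := cauchySeq_tendsto_of_complete (l2.uniformContinuous.comp_cauchySeq hu)
  obtain ⟨w, rfl⟩ := D.closed u v G hv hG
  refine ⟨w, tendsto_iff_norm_sub_tendsto_zero.2 ?_⟩
  have := (tendsto_iff_norm_sub_tendsto_zero.1 hG).const_mul D.const
  rw [mul_zero] at this
  exact this.congr fun k => (D.norm_sub (u k) w).symm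

theorem exists_closedDerivative_one [Fact (1 ≤ critExp n 1 p)] [Fact (1 ≤ ENNReal.ofReal p)] :
    Nonempty (ClosedDerivative n 1 p hp
      (Lp (Rn n) (ENNReal.ofReal p) (volume : Measure (Rn n)))) := by
  choose g hg hgp using fun u : DotW n 1 p hp =>
    exists_isWeakGradient_of_seminormW_lt_top u.seminormW_lt_top
  refine ⟨⟨fun u => (hgp u).toLp (g u), 1, one_pos, fun u v => ?_, fun u v G hu hG => ?_⟩⟩
  · rw [one_mul, ← MemLp.toLp_sub, Lp.norm_toLp, norm_sub_eq, seminormW_one_eq ((hg u).sub (hg v))]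
  · have hw : IsWeakGradient v G := isWeakGradient_of_tendsto hu hG fun k =>
      (hg (u k)).congr_grad (hgp (u k)).coeFn_toLp.symm
    let w : DotW n 1 p hp := (⟨v, by
      change seminormW n 1 p v < ∞
      rw [seminormW_one_eq hw]
      exact (Lp.memLp G).eLpNorm_lt_top⟩ : dotWSubmodule n 1 p hp)
    refine ⟨w, Lp.ext ?_⟩
    exact (hgp w).coeFn_toLp.trans ((hg w).ae_eq hw)

/-- The difference quotient is closed because sequences converging in `L^q` and in `L^p` have
subsequences that converge almost everywhere. -/
theorem exists_closedDerivative (hs0 : 0 < s) (hs1 : s < 1) [Fact (1 ≤ critExp n s p)]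
    [Fact (1 ≤ ENNReal.ofReal p)] :
    Nonempty (ClosedDerivative n s p hp
      (Lp ℝ (ENNReal.ofReal p) (volume : Measure (Rn n × Rn n)))) := by
  have hQ : ∀ u : DotW n s p hp, MemLp (quot n s p u.toLp) (ENNReal.ofReal p) volume := fun u =>
    memLp_quot_of_seminormW_lt_top hs0 hs1 hp (Lp.aestronglyMeasurable _) u.seminormW_lt_top
  obtain ⟨hκ0, hκ⟩ := mul_ofReal_rpow_ne hs0 hs1 hp
  refine ⟨⟨fun u => (hQ u).toLp _, (ENNReal.ofReal (s * (1 - s)) ^ (1 / p)).toReal,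
    ENNReal.toReal_pos hκ0 hκ, fun u v => ?_, fun u v G hu hG => ?_⟩⟩
  · rw [← MemLp.toLp_sub, Lp.norm_toLp, norm_sub_eq, seminormW_of_ne hs1.ne hp, quot_sub,
      ENNReal.toReal_mul]
  · obtain ⟨φ, hφ, hφv⟩ := (tendstoInMeasure_of_tendsto_Lp hu).exists_seq_tendsto_ae
    obtain ⟨ψ, hψ, hψG⟩ :=
      (tendstoInMeasure_of_tendsto_Lp (hG.comp hφ.tendsto_atTop)).exists_seq_tendsto_ae
    have a1 : ∀ᵐ z : Rn n × Rn n ∂(volume.prod volume),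
        Tendsto (fun k => (u (φ k)).toLp z.1) atTop (𝓝 (v z.1)) :=
      Measure.quasiMeasurePreserving_fst.ae hφv
    have a2 : ∀ᵐ z : Rn n × Rn n ∂(volume.prod volume),
        Tendsto (fun k => (u (φ k)).toLp z.2) atTop (𝓝 (v z.2)) :=
      Measure.quasiMeasurePreserving_snd.ae hφv
    have a3 : ∀ᵐ z : Rn n × Rn n, ∀ k, (hQ (u k)).toLp _ z = quot n s p (u k).toLp z :=
      ae_all_iff.2 fun k => (hQ (u k)).coeFn_toLp
    have hGv : quot n s p v =ᵐ[volume] G := by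
      filter_upwards [a1, a2, a3, hψG] with z h1 h2 h3 h4
      simp only [Function.comp, h3] at h4
      refine tendsto_nhds_unique ?_ h4
      exact ((h1.sub h2).const_mul _).comp hψ.tendsto_atTop
    let w : DotW n s p hp := (⟨v, by
      change seminormW n s p v < ∞
      rw [seminormW_of_ne hs1.ne hp, eLpNorm_congr_ae hGv]
      exact ENNReal.mul_lt_top hκ.lt_top (Lp.memLp G).eLpNorm_lt_top⟩ : dotWSubmodule n s p hp)
    exact ⟨w, Lp.ext ((hQ w).coeFn_toLp.trans hGv)⟩

/-! ### The properties of `Ẇ^{s,p}` -/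

theorem exists_norm_toLp_le (hs0 : 0 < s) (hs1 : s ≤ 1) (hsp : s * p < n) :
    ∃ C : ℝ, 0 ≤ C ∧ ∀ u : DotW n s p hp, ‖u.toLp‖ ≤ C * ‖u‖ := by
  obtain ⟨C, hC, h⟩ := exists_eLpNorm_le_mul_seminormW hs0 hs1 hp hsp
  refine ⟨C.toReal, ENNReal.toReal_nonneg, fun u => ?_⟩
  rw [Lp.norm_def, norm_def, ← ENNReal.toReal_mul]
  exact ENNReal.toReal_mono (ENNReal.mul_ne_top hC u.seminormW_lt_top.ne)
    (h _ (Lp.stronglyMeasurable _) (Lp.memLp _) u.seminormW_lt_top)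

theorem eq_zero_of_norm_eq_zero (hs0 : 0 < s) (hs1 : s ≤ 1) (hsp : s * p < n)
    (u : DotW n s p hp) (hu : ‖u‖ = 0) : u = 0 := by
  obtain ⟨C, -, h⟩ := exists_norm_toLp_le (hp := hp) hs0 hs1 hsp
  have h1 := h u
  rw [hu, mul_zero] at h1
  have hq : 0 < critExp n s p := by
    obtain ⟨-, hpq, -⟩ := exponent_facts hs0 hp hsp
    exact ENNReal.ofReal_pos.2 (by linarith)
  exact toLp_injective ((Lp.norm_eq_zero_iff hq).1 (le_antisymm h1 ENNReal.toReal_nonneg))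

theorem completeSpace (hs0 : 0 < s) (hs1 : s ≤ 1) (hsp : s * p < n) :
    CompleteSpace (DotW n s p hp) := by
  obtain ⟨-, hpq, -⟩ := exponent_facts hs0 hp hsp
  have : Fact (1 ≤ ENNReal.ofReal p) := ⟨by simpa using hp⟩
  have : Fact (1 ≤ critExp n s p) := ⟨ENNReal.one_le_ofReal.2 (hp.trans hpq)⟩
  obtain ⟨C, hC0, hC⟩ := exists_norm_toLp_le (hp := hp) hs0 hs1 hsp
  rcases hs1.eq_or_lt with rfl | hs1
  · obtain ⟨D⟩ := exists_closedDerivative_one (n := n) (hp := hp)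
    exact D.completeSpace hC0 hC
  · obtain ⟨D⟩ := exists_closedDerivative (n := n) (hp := hp) hs0 hs1
    exact D.completeSpace hC0 hC

theorem denseRange_incl (hs0 : 0 < s) (hs1 : s ≤ 1) (hsp : s * p < n) :
    DenseRange (incl n s p hs0 hs1 hp) := by
  refine Metric.denseRange_iff.2 fun u r hr => ?_
  obtain ⟨φ, hφ⟩ := exists_test_seminormW_sub_le hs0 hs1 hp hsp (Lp.stronglyMeasurable u.toLp)
    (Lp.memLp _) u.seminormW_lt_top (δ := ENNReal.ofReal (r / 2)) (by simpa using hr)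
  let ψ : TestW n s p hs0 hs1 hp := φ
  have hψ : ((incl n s p hs0 hs1 hp ψ).toLp : Rn n → ℝ) =ᵐ[volume] φ :=
    MemLp.coeFn_toLp (ψ.memLp (critExp n s p))
  refine ⟨ψ, ?_⟩
  rw [dist_eq_norm, norm_sub_eq, seminormW_congr hp ((EventuallyEq.refl _ _).sub hψ)]
  refine (ENNReal.toReal_le_of_le_ofReal (by positivity) hφ).trans_lt (by linarith)

end DotW

/-! ### Identification with the completion -/

/-- The completion of `E` is isometrically isomorphic, compatibly with `i`, to any separated complete
space in which `E` sits densely and isometrically. -/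
theorem exists_linearIsometryEquiv_completion {E F : Type*} [SeminormedAddCommGroup E]
    [NormedSpace ℝ E] [SeminormedAddCommGroup F] [NormedSpace ℝ F] [CompleteSpace F] [T0Space F]
    (i : E →ₗᵢ[ℝ] F) (hi : DenseRange i) :
    ∃ J : UniformSpace.Completion E ≃ₗᵢ[ℝ] F,
      ∀ x : E, J (x : UniformSpace.Completion E) = i x := by
  let e : E →L[ℝ] UniformSpace.Completion E := UniformSpace.Completion.toComplL
  have he : DenseRange e := UniformSpace.Completion.denseRange_coe
  have heu : IsUniformInducing e := UniformSpace.Completion.isUniformInducing_coe E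
  let L : UniformSpace.Completion E →L[ℝ] F := i.toContinuousLinearMap.extend e
  have hL : ∀ x : E, L (x : UniformSpace.Completion E) = i x := fun x =>
    i.toContinuousLinearMap.extend_eq he heu x
  have hnorm : ∀ x, ‖L x‖ = ‖x‖ := fun x =>
    UniformSpace.Completion.induction_on x
      (isClosed_eq (continuous_norm.comp L.continuous) continuous_norm) fun a => by
        rw [hL, i.norm_map, UniformSpace.Completion.norm_coe]
  let J : UniformSpace.Completion E →ₗᵢ[ℝ] F := ⟨L.toLinearMap, hnorm⟩
  have hclosed : IsClosed (range J) := J.isometry.isUniformInducing.isComplete_range.isClosed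
  have hdense : DenseRange J := hi.mono (by
    rintro _ ⟨x, rfl⟩
    exact ⟨(x : UniformSpace.Completion E), hL x⟩)
  have hsurj : Function.Surjective J := by
    rw [← range_eq_univ, ← hclosed.closure_eq]
    exact hdense.closure_eq
  exact ⟨LinearIsometryEquiv.ofSurjective J hsurj, hL⟩

end HomSobolev

open HomSobolev in
theorem theorem3p1 (n : ℕ) (s p : ℝ) (hs0 : 0 < s) (hs1 : s ≤ 1) (hp : 1 ≤ p)
    (hsp : s * p < n) :
    (∀ u : DotW n s p hp, ‖u‖ = 0 → u = 0) ∧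
    CompleteSpace (DotW n s p hp) ∧
    DenseRange (incl n s p hs0 hs1 hp) ∧
    ∃ J : SpaceD n s p hs0 hs1 hp ≃ₗᵢ[ℝ] DotW n s p hp,
      ∀ φ : TestW n s p hs0 hs1 hp,
        J (φ : UniformSpace.Completion (TestW n s p hs0 hs1 hp)) = incl n s p hs0 hs1 hp φ := by
  have hzero := DotW.eq_zero_of_norm_eq_zero (hp := hp) hs0 hs1 hsp
  have hdense := DotW.denseRange_incl (hp := hp) hs0 hs1 hsp
  have hcomplete := DotW.completeSpace (hp := hp) hs0 hs1 hsp
  have : T0Space (DotW n s p hp) := (t0Space_iff_inseparable _).2 fun u v h => by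
    rw [Metric.inseparable_iff, dist_eq_norm] at h
    exact sub_eq_zero.1 (hzero _ h)
  exact ⟨hzero, hcomplete, hdense, exists_linearIsometryEquiv_completion _ hdense⟩
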